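/- Let $\mathcal X,\mathcal Y$ be finite sets, $P_{X,Y}$ a probability distribution on $\mathcal X\times\mathcal Y$, and let $|\psi\rangle\in\mathcal H_A\otimes\mathcal H_B=\mathbb C^{\mathcal X}\otimes\mathbb C^{\mathcal Y}$ be a regular embedding of $P_{X,Y}$, i.e. $|\langle x,y|\psi\rangle|^2=P_{X,Y}(x,y)$ for all $x,y$. Write $|\psi\rangle=\sum_x\sqrt{P_X(x)}\,|x\rangle|\psi_x\rangle$. Let $X\searrow Y:=P_{Y|X=X}$ be the dependent part of $X$ with respect to $Y$ (the random variable $x\mapsto P_{Y|X=x}$ evaluated at Alice's outcome $X$), and similarly $Y\searrow X$. The embedding is *trivial* if $S(X\searrow Y\,|\,B)=0$ or $S(Y\searrow X\,|\,A)=0$, where $S(K|B)=S(KB)-S(B)$ is the conditional von Neumann entropy of a classical variable $K$, computed from the other party's measurement outcome in the computational basis, given the quantum register. An *ideal functionality* assigns to every input in $[0,1]$ of either party a measurement (quantum instrument with finitely many outcomes, encoded in $[0,1]$) of that party's register of $|\psi\rangle$, input $0$ being the measurement in the computational basis; it returns the classical outcome and keeps the residual state. The state $|\psi\rangle$ is *weakly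 self-composable* if there is an ideal functionality such that for each choice of the adversary (Alice or Bob), every $m>0$ and every attack (a POVM with finitely many outcomes on all $m$ registers of the adversary in $|\psi\rangle^{\otimes m}$) there is a classical randomized simulator which, by (adaptive, possibly repeated, finitely many) queries to $m$ independent copies of the functionality, produces an output having the same joint distribution with the honest party's $m$ computational-basis outcomes as the outcome of the attack. Challenge with parameters $x_0,x_1\in\mathcal X$, $c>0$, $m$: Alice measures her $m$ registers of $|\psi\rangle^{\otimes m}$ in the computational basis and gets $X_1,\dots,X_m$. If $x_0$ or $x_1$ occurs fewer than two times, the payoff is $0$. Otherwise she draws $(\alpha,\beta)\in\{x_0,x_1\}^2$ uniformly, then an ordered pair of positions $h\neq h'$ uniformly among those with $(X_h,X_{h'})=(\alpha,\beta)$, and announces $(h,h')$. Bob answers "equal", "different" or "don't know"; the payoff is $1$ if he answers correctly whether $\alpha=\beta$, $-c$ if he answers incorrectly, and $0$ if he answers "don't know". Theorem. (i) If $|\psi\rangle$ is weakly self-composable, then it is a trivial embedding of $P_{X,Y}$. (ii) If $|\psi\rangle$ is non-trivial, then there are $x_0,x_1\in\mathcal X$ with $P_X(x_0),P_X(x_1)>0$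 and $0<|\langle\psi_{x_0}|\psi_{x_1}\rangle|<1$, and there are $c>0$, $\varepsilon>0$ and $M$ such that for every $m\ge M$ there is a coherent strategy of Bob in the challenge (for each announcement $(h,h')$ a POVM on his $m$ registers) whose expected payoff exceeds by at least $\varepsilon$ the expected payoff of every strategy that, after the announcement, only uses classical randomness and queries to $m$ independent copies of an ideal functionality, whatever that ideal functionality is. -/

import Mathlib

open scoped Kronecker Matrix ComplexOrder

noncomputable section

namespace Composability

/-! ### Entropies, embeddings, triviality -/

/-- Von Neumann entropy of a Hermitian matrix: the Shannon entropy (natural logarithm) of its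
eigenvalues. -/
def vonNeumannEntropy {n : Type*} [Fintype n] [DecidableEq n] {A : Matrix n n ℂ}
    (hA : A.IsHermitian) : ℝ :=
  ∑ i, Real.negMulLog (hA.eigenvalues i)

section Embedding

variable {X Y : Type*} [Fintype X] [Fintype Y]

/-- The conditional distribution `P_{Y|X=x}`. The dependent part of `X` with respect to `Y` is the
random variable `condDist P X`. -/
def condDist (P : X × Y → ℝ) (x : X) : Y → ℝ :=
  fun y => P (x, y) / ∑ y', P (x, y')

/-- Exchange the roles of Alice and Bob in a joint distribution. -/
def swapDist (P : X × Y → ℝ) : Y × X → ℝ := fun p => P p.swap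

/-- Exchange the roles of Alice and Bob in a bipartite pure state. -/
def swapState (ψ : EuclideanSpace ℂ (X × Y)) : EuclideanSpace ℂ (Y × X) :=
  WithLp.toLp 2 fun p => ψ p.swap

/-- A pure state of the registers `A`, `B` (computational bases `X`, `Y`, no auxiliary registers) is
a regular embedding of `P` if measuring both registers in the computational basis has law `P`,
i.e. `ψ = ∑ exp(iθ(x,y)) √P(x,y) |x,y⟩`. Since the auxiliary registers are trivial, the correctness
condition `S(X;YB') = S(XA';Y) = I(X;Y)` holds by itself. -/
def IsRegularEmbedding (P : X × Y → ℝ) (ψ : EuclideanSpace ℂ (X × Y)) : Prop :=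
  ∀ p, ‖ψ p‖ ^ 2 = P p

/-- Bob's normalized state `|ψ_x⟩` after Alice has obtained `x`, so that
`ψ = ∑ x, √P_X(x) |x⟩ ⊗ |ψ_x⟩`. -/
def condState (P : X × Y → ℝ) (ψ : EuclideanSpace ℂ (X × Y)) (x : X) : EuclideanSpace ℂ Y :=
  WithLp.toLp 2 fun y => ((√(∑ y', P (x, y')) : ℝ) : ℂ)⁻¹ * ψ (x, y)

/-- Reduced density matrix of the second register. -/
def reducedState {X Y : Type*} [Fintype X] (ψ : EuclideanSpace ℂ (X × Y)) : Matrix Y Y ℂ :=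
  fun y y' => ∑ x, ψ (x, y) * star (ψ (x, y'))

open Classical in
/-- Joint state of the classical variable `condDist P X` (the dependent part of `X` with respect to
`Y`, where `X` is the outcome of measuring the first register in the computational basis) and of the
second register: `∑ d, |d⟩⟨d| ⊗ ∑ (x with P_{Y|X=x} = d), P_X(x) |ψ_x⟩⟨ψ_x|`. -/
def depState (P : X × Y → ℝ) (ψ : EuclideanSpace ℂ (X × Y)) :
    Matrix (Set.range (condDist P) × Y) (Set.range (condDist P) × Y) ℂ :=
  fun a b => if a.1 = b.1 then
    ∑ x, if condDist P x = a.1 then ψ (x, a.2) * star (ψ (x, b.2)) else 0 else 0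

theorem reducedState_isHermitian {X Y : Type*} [Fintype X] (ψ : EuclideanSpace ℂ (X × Y)) :
    (reducedState ψ).IsHermitian := by
  ext y y'
  simp [reducedState, Matrix.conjTranspose_apply, mul_comm]

theorem depState_isHermitian (P : X × Y → ℝ) (ψ : EuclideanSpace ℂ (X × Y)) :
    (depState P ψ).IsHermitian := by
  ext ⟨d, y⟩ ⟨d', y'⟩
  by_cases h : d = d'
  · subst h
    simp only [depState, Matrix.conjTranspose_apply, if_true, star_sum]
    refine Finset.sum_congr rfl fun x _ => ?_
    split_ifs <;> simp [mul_comm]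
  · simp [depState, Matrix.conjTranspose_apply, h, Ne.symm h]

open Classical in
/-- `S(X↘Y | B) = S((X↘Y) B) - S(B)`. -/
def depEntropy (P : X × Y → ℝ) (ψ : EuclideanSpace ℂ (X × Y)) : ℝ :=
  vonNeumannEntropy (depState_isHermitian P ψ) - vonNeumannEntropy (reducedState_isHermitian ψ)

/-- Trivial embedding: `S(Y↘X | A) = 0` or `S(X↘Y | B) = 0`. -/
def IsTrivial (P : X × Y → ℝ) (ψ : EuclideanSpace ℂ (X × Y)) : Prop :=
  depEntropy (swapDist P) (swapState ψ) = 0 ∨ depEntropy P ψ = 0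

end Embedding

/-! ### Attacks on several copies -/

/-- A POVM with outcomes in `O` on the register with computational basis `S`. -/
structure POVM (S O : Type*) [Fintype S] [DecidableEq S] [Fintype O] where
  elem : O → Matrix S S ℂ
  posSemidef : ∀ o, (elem o).PosSemidef
  sum_eq_one : ∑ o, elem o = 1

section Attack

/- `H` is the (computational basis of the) register of the honest party, `D` that of the dishonest
party. -/
variable {H D O : Type*} [Fintype H] [Fintype D] [DecidableEq H] [DecidableEq D] [Fintype O] {m : ℕ}

/-- The unnormalized state `(⟨x| ⊗ 1) |ψ⟩^{⊗m}` of the dishonest party's `m` registers when the honest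
party gets `x = (x_1, …, x_m)`. -/
def residualVector (ψ : EuclideanSpace ℂ (H × D)) (x : Fin m → H) : (Fin m → D) → ℂ :=
  fun y => ∏ i, ψ (x i, y i)

/-- Real world: the probability that, on `|ψ⟩^{⊗m}`, the honest party measures `x` in the
computational basis and the attack, a POVM on all `m` registers of the dishonest party jointly,
gives `o`. -/
def attackProb (ψ : EuclideanSpace ℂ (H × D)) (E : POVM (Fin m → D) O) (x : Fin m → H) (o : O) : ℝ :=
  (star (residualVector ψ x) ⬝ᵥ (E.elem o *ᵥ residualVector ψ x)).re

end Attack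

/-! ### Ideal functionalities and simulation -/

/-- A measurement with finitely many classical outcomes, encoded in `[0,1]`, together with the
residual state: outcome `w` maps `σ` to `∑ k, K_{w,k} σ K_{w,k}ᴴ` (unnormalized). -/
structure Instrument (S : Type*) [Fintype S] [DecidableEq S] where
  outcomes : Finset unitInterval
  rank : ℕ
  kraus : unitInterval → Fin rank → Matrix S S ℂ
  complete : ∑ w ∈ outcomes, ∑ k, (kraus w k)ᴴ * kraus w k = 1

/-- The measurement in the computational basis, with outcome `s` encoded as `enc s`. -/
def Instrument.computational {S : Type*} [Fintype S] [DecidableEq S] (enc : S ↪ unitInterval) :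
    Instrument S where
  outcomes := Finset.univ.map enc
  rank := 1
  kraus w _ := Matrix.diagonal fun s => if enc s = w then 1 else 0
  complete := by
    ext s t
    simp only [Matrix.diagonal_conjTranspose, Matrix.diagonal_mul_diagonal, Finset.sum_map,
      Matrix.sum_apply]
    by_cases h : s = t
    · subst h; simp
    · simp [h]

/-- An ideal functionality for states of the registers `A`, `B`: each party has inputs in `[0,1]`,
each input specifies a measurement of that party's register, and input `0` is the honest
measurement in the computational basis. Which measurements the other inputs encode is arbitrary. -/
structure IdealFunctionality (X Y : Type*) [Fintype X] [Fintype Y] [DecidableEq X]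
    [DecidableEq Y] where
  encA : X ↪ unitInterval
  encB : Y ↪ unitInterval
  alice : unitInterval → Instrument X
  bob : unitInterval → Instrument Y
  alice_zero : alice 0 = Instrument.computational encA
  bob_zero : bob 0 = Instrument.computational encB

/-- A (classical) simulator with access to one party's interface of `m` independent ideal
functionalities: it may toss biased coins, query adaptively any of the functionalities (any number
of times) and continue according to the outcome, and finally output an element of `O`. -/
inductive Simulator (m : ℕ) (O : Type) : Type
  | output (o : O) : Simulator m O
  | coin (p : unitInterval) (a b : Simulator m O) : Simulator m O
  | query (i : Fin m) (s : unitInterval) (next : unitInterval → Simulator m O) : Simulator m O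

section Simulation

variable {H D : Type*} [Fintype H] [Fintype D] [DecidableEq H] [DecidableEq D] {m : ℕ} {O : Type}

/-- Unnormalized residual state of one functionality after the dishonest party's measurement `M`,
applied to its register only, has given `w`. -/
def Instrument.residual (M : Instrument D) (w : unitInterval) (σ : Matrix (H × D) (H × D) ℂ) :
    Matrix (H × D) (H × D) ℂ :=
  ∑ k, ((1 : Matrix H H ℂ) ⊗ₖ M.kraus w k) * σ * ((1 : Matrix H H ℂ) ⊗ₖ M.kraus w k)ᴴ

/-- The state `|ψ⟩⟨ψ|` in which every functionality starts. -/
def initialState (ψ : EuclideanSpace ℂ (H × D)) : Matrix (H × D) (H × D) ℂ :=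
  fun p q => ψ p * star (ψ q)

open Classical in
/-- Ideal world: `S.prob F σ x o` is the probability that the honest party, measuring in the
computational basis, gets `x_i` from the `i`-th functionality for all `i`, and that the simulator
`S` outputs `o`, where `F` lists the measurements that the dishonest party's inputs stand for and
`σ i` is the current (unnormalized) state of the `i`-th functionality. -/
def Simulator.prob (F : unitInterval → Instrument D) :
    Simulator m O → (Fin m → Matrix (H × D) (H × D) ℂ) → (Fin m → H) → O → ℝ
  | .output o', σ, x, o => if o' = o then ∏ i, (∑ y, σ i (x i, y) (x i, y)).re else 0
  | .coin p a b, σ, x, o => p * a.prob F σ x o + (1 - p) * b.prob F σ x o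
  | .query i s next, σ, x, o =>
      ∑ w ∈ (F s).outcomes, (next w).prob F (Function.update σ i ((F s).residual w (σ i))) x o

/-- The joint law of the honest outcomes and the simulator's output, from `m` functionalities
holding `ψ` each. -/
def simProb (F : unitInterval → Instrument D) (ψ : EuclideanSpace ℂ (H × D)) (S : Simulator m O)
    (x : Fin m → H) (o : O) : ℝ :=
  S.prob F (fun _ => initialState ψ) x o

/-- Every attack of the second party on `ψ^{⊗m}`, for every `m > 0`, is simulated by calls to `m`
functionalities: the joint law of the honest outcomes and of the adversary's output is the same. -/
def SimulatesAttacks (F : unitInterval → Instrument D) (ψ : EuclideanSpace ℂ (H × D)) : Prop :=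
  ∀ (m : ℕ), 0 < m → ∀ (O : Type) [Fintype O] (E : POVM (Fin m → D) O),
    ∃ S : Simulator m O, ∀ x o, simProb F ψ S x o = attackProb ψ E x o

end Simulation

/-- Weak self-composability: some ideal functionality allows one to simulate all attacks, by either
party, on any number of copies. -/
def WeaklySelfComposable {X Y : Type*} [Fintype X] [Fintype Y] [DecidableEq X] [DecidableEq Y]
    (ψ : EuclideanSpace ℂ (X × Y)) : Prop :=
  ∃ I : IdealFunctionality X Y,
    SimulatesAttacks I.bob ψ ∧ SimulatesAttacks I.alice (swapState ψ)

/-! ### The state comparison challenge -/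

section Challenge

variable {X : Type*} [DecidableEq X] {m : ℕ}

/-- The ordered pairs of distinct positions at which Alice's outcomes are `(α, β)`. -/
def pairPositions (x : Fin m → X) (α β : X) : Finset (Fin m × Fin m) :=
  Finset.univ.filter fun h => h.1 ≠ h.2 ∧ x h.1 = α ∧ x h.2 = β

/-- The probability that Alice, having measured `x`, announces the positions `h = (h₁, h₂)`. If `x`
does not contain both `x₀` and `x₁` at least twice, she aborts. Otherwise she draws `(α, β)`
uniformly from `{x₀, x₁}²`, and then `h` uniformly among the pairs of distinct positions with
outcomes `(α, β)`. -/
def announceProb (x₀ x₁ : X) (x : Fin m → X) (h : Fin m × Fin m) : ℝ :=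
  if (pairPositions x x₀ x₀).Nonempty ∧ (pairPositions x x₁ x₁).Nonempty ∧ h.1 ≠ h.2 ∧
      (x h.1 = x₀ ∨ x h.1 = x₁) ∧ (x h.2 = x₀ ∨ x h.2 = x₁) then
    1 / 4 * (1 / ((pairPositions x (x h.1) (x h.2)).card : ℝ))
  else 0

/-- Bob's payoff: `0` for "don't know" (`none`), `1` for a correct answer (`some true` for "equal",
`some false` for "different"), `-c` for a wrong one. -/
def score (c : ℝ) (equal : Bool) : Option Bool → ℝ
  | none => 0
  | some b => if b = equal then 1 else -c

/-- Expected payoff in the challenge (an abort pays `0`), if `R h x b` is the probability that Alice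
measures `x` and that Bob, using his strategy for the announcement `h`, answers `b`. -/
def challengePayoff [Fintype X] (x₀ x₁ : X) (c : ℝ)
    (R : Fin m × Fin m → (Fin m → X) → Option Bool → ℝ) : ℝ :=
  ∑ x : Fin m → X, ∑ h, announceProb x₀ x₁ x h *
    ∑ b, R h x b * score c (decide (x h.1 = x h.2)) b

end Challenge

end Composability

end

/-!
If `S(X↘Y|B) ≠ 0`, then two of Bob's conditional states, `ψ_{x₀}` and `ψ_{x₁}`, overlap without
being parallel: otherwise the Gram matrices factoring the states of `(X↘Y)B` and `B` would agree.
Let `0 < s < 1` be the absolute value of their inner product.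

* A joint measurement of two registers compares the two states unambiguously with success
  probability `1 - s`: if the states are embedded in `ℂ²` symmetrically about an axis, then with
  `r = (1 - s) / (1 + s)` the vectors `|01⟩ - |10⟩` and `r|00⟩ - |11⟩` are orthogonal to products of
  equal states, while `|01⟩ + |10⟩` and `r|00⟩ + |11⟩` are orthogonal to products of different ones.
* A query to a functionality replaces Alice's reduced state by an ensemble with the same mean. Hence
  Bob's payoff is bounded by any multilinear functional of the reduced states that bounds it at the
  leaves of his strategy. The quadratic form at `|x₀⟩/√P_X(x₀) - ω|x₁⟩/√P_X(x₁)`, divided by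
  `1 - δ`, on each of the two announced registers is such a functional when the penalty is
  `c = 2 / δ`; its value is `((1 - s) / (1 - δ))²` after normalisation, which is less than `1 - s`
  for `δ = s / 2`.

The announcement is not independent across positions, but the numbers of pairs of positions
concentrate, so its probabilities are within `o(1)` of weights that factorise.
-/

noncomputable section

namespace Composability

/-! ### Entropy of the dependent part -/

section Entropy

theorem vonNeumannEntropy_eq_sum_roots {n : Type*} [Fintype n] [DecidableEq n] {A : Matrix n n ℂ}
    (hA : A.IsHermitian) :
    vonNeumannEntropy hA = (A.charpoly.roots.map fun z => Real.negMulLog z.re).sum := by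
  simp [hA.roots_charpoly_eq_eigenvalues, vonNeumannEntropy]

theorem sum_map_roots_X_pow_mul {R M : Type*} [CommRing R] [IsDomain R] [AddCommMonoid M]
    {f : R → M} (hf : f 0 = 0) (k : ℕ) {p : Polynomial R} (hp : p ≠ 0) :
    ((Polynomial.X ^ k * p).roots.map f).sum = (p.roots.map f).sum := by
  rw [Polynomial.roots_mul (mul_ne_zero (pow_ne_zero _ Polynomial.X_ne_zero) hp),
    Polynomial.roots_X_pow]
  simp [Multiset.map_nsmul, Multiset.sum_nsmul, hf]

theorem vonNeumannEntropy_eq_of_mul_comm {n k : Type*} [Fintype n] [DecidableEq n] [Fintype k]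
    [DecidableEq k] {L : Matrix n k ℂ} {N : Matrix k n ℂ} (hLN : (L * N).IsHermitian)
    (hNL : (N * L).IsHermitian) : vonNeumannEntropy hLN = vonNeumannEntropy hNL := by
  have hroots := @sum_map_roots_X_pow_mul ℂ ℝ _ _ _ (fun z => Real.negMulLog z.re) (by simp)
  rw [vonNeumannEntropy_eq_sum_roots, vonNeumannEntropy_eq_sum_roots,
    ← hroots (Fintype.card k) (Matrix.charpoly_monic _).ne_zero, Matrix.charpoly_mul_comm' L N,
    hroots (Fintype.card n) (Matrix.charpoly_monic _).ne_zero]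

end Entropy

section ConditionalStates

variable {X Y : Type*}

/-- Bob's unnormalised state `(⟨x| ⊗ 1)|ψ⟩` after Alice has obtained `x`. -/
def branch (ψ : EuclideanSpace ℂ (X × Y)) (x : X) : EuclideanSpace ℂ Y :=
  WithLp.toLp 2 fun y => ψ (x, y)

/-- The matrix `∑ x, |(⟨x| ⊗ 1)ψ⟩⟨x|` of amplitudes of `ψ`, which factors Bob's reduced state. -/
def amplitudeMatrix (ψ : EuclideanSpace ℂ (X × Y)) : Matrix Y X ℂ :=
  Matrix.of fun y x => branch ψ x y

theorem reducedState_eq_mul_conjTranspose [Fintype X] (ψ : EuclideanSpace ℂ (X × Y)) :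
    reducedState ψ = amplitudeMatrix ψ * (amplitudeMatrix ψ)ᴴ := by
  ext y y'
  simp [reducedState, Matrix.mul_apply, amplitudeMatrix, branch]

variable [Fintype Y]

theorem conjTranspose_amplitudeMatrix_mul_self (ψ : EuclideanSpace ℂ (X × Y)) :
    (amplitudeMatrix ψ)ᴴ * amplitudeMatrix ψ = Matrix.gram ℂ (branch ψ) := by
  ext x x'
  simp [Matrix.mul_apply, amplitudeMatrix, Matrix.gram_apply, PiLp.inner_apply, mul_comm]

open Classical in
/-- The matrix `∑ x, |P_{Y|X=x}⟩ ⊗ |(⟨x| ⊗ 1)ψ⟩⟨x|`, which factors `depState`. -/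
def depAmplitudeMatrix (P : X × Y → ℝ) (ψ : EuclideanSpace ℂ (X × Y)) :
    Matrix (Set.range (condDist P) × Y) X ℂ :=
  Matrix.of fun a x => if condDist P x = a.1 then branch ψ x a.2 else 0

theorem depState_eq_mul_conjTranspose [Fintype X] (P : X × Y → ℝ)
    (ψ : EuclideanSpace ℂ (X × Y)) :
    depState P ψ = depAmplitudeMatrix P ψ * (depAmplitudeMatrix P ψ)ᴴ := by
  ext ⟨d, y⟩ ⟨d', y'⟩
  simp only [depState, Matrix.mul_apply, Matrix.conjTranspose_apply, depAmplitudeMatrix,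
    Matrix.of_apply, branch]
  split_ifs with hd
  · refine Finset.sum_congr rfl fun x _ => ?_
    split_ifs <;> simp_all
  · refine (Finset.sum_eq_zero fun x _ => ?_).symm
    by_cases hx : condDist P x = d
    · simp [hx, Subtype.coe_inj, hd]
    · simp [hx]

theorem conjTranspose_depAmplitudeMatrix_mul_self [Fintype X] {P : X × Y → ℝ}
    {ψ : EuclideanSpace ℂ (X × Y)}
    (h : ∀ x x', condDist P x ≠ condDist P x' → inner ℂ (branch ψ x) (branch ψ x') = 0) :
    (depAmplitudeMatrix P ψ)ᴴ * depAmplitudeMatrix P ψ = Matrix.gram ℂ (branch ψ) := by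
  classical
  ext x x'
  simp only [Matrix.mul_apply, Matrix.conjTranspose_apply, depAmplitudeMatrix, Matrix.of_apply,
    Fintype.sum_prod_type]
  rw [Finset.sum_eq_single (⟨condDist P x, x, rfl⟩ : Set.range (condDist P))]
  · by_cases hx : condDist P x = condDist P x'
    · simp [hx, Matrix.gram_apply, PiLp.inner_apply, mul_comm]
    · simp [Matrix.gram_apply, h x x' hx, Ne.symm hx]
  · intro d _ hd
    have hxd : condDist P x ≠ d := fun hxd => hd (Subtype.ext hxd.symm)
    simp [hxd]
  · simp

theorem depEntropy_eq_zero_of_orthogonal [Fintype X] {P : X × Y → ℝ}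
    {ψ : EuclideanSpace ℂ (X × Y)}
    (h : ∀ x x', condDist P x ≠ condDist P x' → inner ℂ (branch ψ x) (branch ψ x') = 0) :
    depEntropy P ψ = 0 := by
  classical
  have hdep := conjTranspose_depAmplitudeMatrix_mul_self h
  have hamp := conjTranspose_amplitudeMatrix_mul_self ψ
  have hgram := Matrix.isHermitian_gram ℂ (branch ψ)
  have hS : vonNeumannEntropy (depState_isHermitian P ψ) = vonNeumannEntropy hgram := by
    simp only [depState_eq_mul_conjTranspose, ← hdep]
    exact vonNeumannEntropy_eq_of_mul_comm _ _
  have hB : vonNeumannEntropy (reducedState_isHermitian ψ) = vonNeumannEntropy hgram := by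
    simp only [reducedState_eq_mul_conjTranspose, ← hamp]
    exact vonNeumannEntropy_eq_of_mul_comm _ _
  unfold depEntropy
  convert sub_eq_zero.2 (hS.trans hB.symm)

/-- The distribution `P_X` of Alice's outcome. -/
def marginal (P : X × Y → ℝ) (x : X) : ℝ := ∑ y, P (x, y)

theorem sum_marginal [Fintype X] (P : X × Y → ℝ) : ∑ x, marginal P x = ∑ p, P p :=
  (Fintype.sum_prod_type P).symm

theorem condState_eq_smul_branch (P : X × Y → ℝ) (ψ : EuclideanSpace ℂ (X × Y)) (x : X) :
    condState P ψ x = ((√(marginal P x) : ℝ) : ℂ)⁻¹ • branch ψ x :=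
  rfl

variable {P : X × Y → ℝ} {ψ : EuclideanSpace ℂ (X × Y)}

theorem norm_branch_sq (hψ : IsRegularEmbedding P ψ) (x : X) : ‖branch ψ x‖ ^ 2 = marginal P x := by
  simp [EuclideanSpace.norm_sq_eq, branch, marginal, hψ (x, _)]

theorem norm_branch (hψ : IsRegularEmbedding P ψ) (x : X) : ‖branch ψ x‖ = √(marginal P x) := by
  rw [← norm_branch_sq hψ, Real.sqrt_sq (norm_nonneg _)]

theorem marginal_nonneg (hψ : IsRegularEmbedding P ψ) (x : X) : 0 ≤ marginal P x :=
  norm_branch_sq hψ x ▸ sq_nonneg _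

theorem marginal_pos (hψ : IsRegularEmbedding P ψ) {x : X} (hx : branch ψ x ≠ 0) :
    0 < marginal P x :=
  norm_branch_sq hψ x ▸ pow_pos (norm_pos_iff.2 hx) 2

theorem norm_condState (hψ : IsRegularEmbedding P ψ) {x : X} (hx : 0 < marginal P x) :
    ‖condState P ψ x‖ = 1 := by
  rw [condState_eq_smul_branch, norm_smul, norm_branch hψ, norm_inv, Complex.norm_real,
    Real.norm_of_nonneg (Real.sqrt_nonneg _), inv_mul_cancel₀ (Real.sqrt_pos.2 hx).ne']

theorem branch_eq_smul_condState {x : X} (hx : 0 < marginal P x) :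
    branch ψ x = ((√(marginal P x) : ℝ) : ℂ) • condState P ψ x := by
  rw [condState_eq_smul_branch, smul_inv_smul₀]
  exact_mod_cast (Real.sqrt_pos.2 hx).ne'

theorem norm_condState_apply_sq (hψ : IsRegularEmbedding P ψ) (x : X) (y : Y) :
    ‖condState P ψ x y‖ ^ 2 = condDist P x y := by
  have hx : √(marginal P x) ^ 2 = marginal P x := Real.sq_sqrt (marginal_nonneg hψ x)
  rw [condState_eq_smul_branch, PiLp.smul_apply, norm_smul, mul_pow, norm_inv, Complex.norm_real,
    inv_pow, Real.norm_eq_abs, sq_abs, hx, inv_mul_eq_div]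
  exact congrArg (· / marginal P x) (hψ (x, y))

theorem condDist_eq_of_norm_inner_eq_one (hψ : IsRegularEmbedding P ψ) {x x' : X}
    (hx : 0 < marginal P x) (hx' : 0 < marginal P x')
    (h : ‖inner ℂ (condState P ψ x) (condState P ψ x')‖ = 1) : condDist P x = condDist P x' := by
  have hu := norm_condState hψ hx
  have hu' := norm_condState hψ hx'
  obtain ⟨r, -, hr⟩ := (norm_inner_eq_norm_iff (norm_ne_zero_iff.1 (hu ▸ one_ne_zero))
    (norm_ne_zero_iff.1 (hu' ▸ one_ne_zero))).1 (by rw [h, hu, hu', one_mul])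
  have hr_norm : ‖r‖ = 1 := by rwa [hr, norm_smul, hu, mul_one] at hu'
  funext y
  rw [← norm_condState_apply_sq hψ, ← norm_condState_apply_sq hψ, hr, PiLp.smul_apply, norm_smul,
    hr_norm, one_mul]

theorem exists_overlap_of_depEntropy_ne_zero [Fintype X] (hψ : IsRegularEmbedding P ψ)
    (h : depEntropy P ψ ≠ 0) :
    ∃ x₀ x₁ : X, 0 < marginal P x₀ ∧ 0 < marginal P x₁ ∧
      0 < ‖inner ℂ (condState P ψ x₀) (condState P ψ x₁)‖ ∧
      ‖inner ℂ (condState P ψ x₀) (condState P ψ x₁)‖ < 1 := by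
  obtain ⟨x, x', hdist, hinner⟩ : ∃ x x', condDist P x ≠ condDist P x' ∧
      inner ℂ (branch ψ x) (branch ψ x') ≠ 0 := by
    by_contra! hcon
    exact h (depEntropy_eq_zero_of_orthogonal hcon)
  have hx : 0 < marginal P x := marginal_pos hψ fun h0 => hinner (by rw [h0, inner_zero_left])
  have hx' : 0 < marginal P x' := marginal_pos hψ fun h0 => hinner (by rw [h0, inner_zero_right])
  refine ⟨x, x', hx, hx', norm_pos_iff.2 fun h0 => hinner ?_, lt_of_le_of_ne ?_ fun h1 =>
    hdist (condDist_eq_of_norm_inner_eq_one hψ hx hx' h1)⟩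
  · rw [branch_eq_smul_condState hx, branch_eq_smul_condState hx', inner_smul_left,
      inner_smul_right, h0, mul_zero, mul_zero]
  · simpa only [norm_condState hψ hx, norm_condState hψ hx', one_mul] using
      norm_inner_le_norm (𝕜 := ℂ) (condState P ψ x) (condState P ψ x')

end ConditionalStates

/-! ### Splitting off two coordinates -/

section Pairs

variable {ι : Type*} [DecidableEq ι] {i j : ι}

theorem prod_eq_mul_mul_prod_subtype {M : Type*} [Fintype ι] [CommMonoid M] (hij : i ≠ j)
    (f : ι → M) : ∏ k, f k = f i * f j * ∏ k : {k // k ≠ i ∧ k ≠ j}, f k := by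
  rw [← Finset.mul_prod_erase _ f (Finset.mem_univ i), ← Finset.mul_prod_erase _ f
    (Finset.mem_erase.2 ⟨hij.symm, Finset.mem_univ j⟩), mul_assoc,
    Finset.prod_subtype (p := fun k => k ≠ i ∧ k ≠ j) _ (fun k => by simp [and_comm]) f]

/-- A family indexed by `ι` as its members at `i` and `j`, and the family of all others. -/
def pairEquiv {Y : Type*} (hij : i ≠ j) :
    (ι → Y) ≃ (Y × Y) × ({k // k ≠ i ∧ k ≠ j} → Y) where
  toFun y := ((y i, y j), fun k => y k)
  invFun q k := if hi : k = i then q.1.1 else if hj : k = j then q.1.2 else q.2 ⟨k, hi, hj⟩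
  left_inv y := by
    ext k
    dsimp only
    split_ifs with hi hj
    · rw [hi]
    · rw [hj]
    · rfl
  right_inv q := by
    refine Prod.ext (Prod.ext ?_ ?_) (funext fun k => ?_)
    · simp
    · simp [hij.symm]
    · simp [k.2.1, k.2.2]

theorem sum_prod_mul_pair {X R : Type*} [Fintype ι] [Fintype X] [CommSemiring R] (hij : i ≠ j)
    (w : ι → X → R) (g : X → X → R) :
    ∑ x : ι → X, (∏ k, w k (x k)) * g (x i) (x j) =
      (∑ a, ∑ b, w i a * w j b * g a b) * ∏ k : {k // k ≠ i ∧ k ≠ j}, ∑ a, w k a := by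
  calc ∑ x : ι → X, (∏ k, w k (x k)) * g (x i) (x j)
      = ∑ p : (X × X) × ({k // k ≠ i ∧ k ≠ j} → X),
          w i p.1.1 * w j p.1.2 * g p.1.1 p.1.2 * ∏ k : {k // k ≠ i ∧ k ≠ j}, w k (p.2 k) :=
        Fintype.sum_equiv (pairEquiv hij) _ _ fun x => by
          rw [prod_eq_mul_mul_prod_subtype hij, mul_right_comm]
          rfl
    _ = _ := by
      simp only [Fintype.prod_sum, Fintype.sum_prod_type, Finset.sum_mul]
      simp only [Finset.mul_sum]

end Pairs

/-! ### Quadratic forms -/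

section QuadForm

variable {S T : Type*}

/-- The product vector `v ⊗ w`. -/
def tensorVec (v : S → ℂ) (w : T → ℂ) : S × T → ℂ := fun p => v p.1 * w p.2

theorem tensorVec_smul_smul (γ δ : ℂ) (v : S → ℂ) (w : T → ℂ) :
    tensorVec (γ • v) (δ • w) = (γ * δ) • tensorVec v w := by
  ext p
  simp only [tensorVec, Pi.smul_apply, smul_eq_mul]
  ring

variable [Fintype S] [Fintype T]

/-- The expectation `re ⟨v|G|v⟩` of an observable `G` in the (unnormalised) state `v`, as a
functional of `G`. -/
def quadForm (v : S → ℂ) : Matrix S S ℂ →ₗ[ℝ] ℝ where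
  toFun G := (star v ⬝ᵥ (G *ᵥ v)).re
  map_add' G G' := by rw [Matrix.add_mulVec, dotProduct_add, Complex.add_re]
  map_smul' r G := by
    rw [Matrix.smul_mulVec, dotProduct_smul, Complex.smul_re, RingHom.id_apply]

theorem quadForm_apply (v : S → ℂ) (G : Matrix S S ℂ) :
    quadForm v G = (star v ⬝ᵥ (G *ᵥ v)).re :=
  rfl

theorem quadForm_nonneg (v : S → ℂ) {G : Matrix S S ℂ} (hG : G.PosSemidef) : 0 ≤ quadForm v G :=
  hG.re_dotProduct_nonneg v

theorem quadForm_smul (γ : ℂ) (v : S → ℂ) (G : Matrix S S ℂ) :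
    quadForm (γ • v) G = ‖γ‖ ^ 2 * quadForm v G := by
  have hγ : star γ * γ = ((‖γ‖ ^ 2 : ℝ) : ℂ) := by
    rw [Complex.star_def, Complex.conj_mul', Complex.ofReal_pow]
  rw [quadForm_apply, Matrix.mulVec_smul, star_smul, smul_dotProduct, dotProduct_smul, smul_smul,
    hγ, smul_eq_mul, Complex.re_ofReal_mul, quadForm_apply]

theorem quadForm_vecMulVec_star (v w : S → ℂ) :
    quadForm v (Matrix.vecMulVec w (star w)) = ‖star w ⬝ᵥ v‖ ^ 2 := by
  have h : star v ⬝ᵥ w = star (star w ⬝ᵥ v) := by rw [Matrix.star_dotProduct]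
  rw [quadForm_apply, Matrix.vecMulVec_mulVec, dotProduct_smul, h, MulOpposite.smul_eq_mul_unop,
    MulOpposite.unop_op, Complex.star_def, Complex.conj_mul', ← Complex.ofReal_pow,
    Complex.ofReal_re]

theorem quadForm_mul_mul_conjTranspose (v : S → ℂ) (B : Matrix S T ℂ) (A : Matrix T T ℂ) :
    quadForm v (B * A * Bᴴ) = quadForm (Bᴴ *ᵥ v) A := by
  simp only [quadForm_apply, Matrix.star_mulVec, Matrix.conjTranspose_conjTranspose,
    ← Matrix.dotProduct_mulVec, Matrix.mulVec_mulVec, Matrix.mul_assoc]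

theorem quadForm_submatrix_equiv (e : S ≃ T) (v : T → ℂ) (G : Matrix T T ℂ) :
    quadForm (v ∘ e) (G.submatrix e e) = quadForm v G := by
  rw [quadForm_apply, Matrix.submatrix_mulVec_equiv, Function.comp_assoc, Equiv.self_comp_symm,
    Function.comp_id, quadForm_apply, ← comp_equiv_dotProduct_comp_equiv (star v) _ e]
  rfl

theorem quadForm_single [DecidableEq S] (a : S) (z : ℂ) (G : Matrix S S ℂ) :
    quadForm (Pi.single a z) G = ‖z‖ ^ 2 * (G a a).re := by
  have h : quadForm (Pi.single a 1) G = (G a a).re := by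
    simp [quadForm_apply]
  rw [← h, ← quadForm_smul, ← Pi.single_smul, smul_eq_mul, mul_one]

/-- The two sides differ by `((1 - δ) * δ)⁻¹ * quadForm (δ • u - w) G`. -/
theorem quadForm_le_add {G : Matrix S S ℂ} (hG : G.PosSemidef) {δ : ℝ} (hδ₀ : 0 < δ) (hδ₁ : δ < 1)
    (u w : S → ℂ) :
    quadForm u G ≤ (1 - δ)⁻¹ * quadForm (u - w) G + δ⁻¹ * quadForm w G := by
  have hδ : 0 < 1 - δ := sub_pos.2 hδ₁
  have hsub (r : ℝ) : quadForm ((r : ℂ) • u - w) G =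
      r ^ 2 * quadForm u G - r * ((star u ⬝ᵥ (G *ᵥ w)).re + (star w ⬝ᵥ (G *ᵥ u)).re) +
        quadForm w G := by
    simp only [Complex.coe_smul, quadForm_apply, star_sub, star_smul, star_trivial,
      Matrix.mulVec_sub, Matrix.mulVec_smul, dotProduct_sub, dotProduct_smul, sub_dotProduct,
      smul_dotProduct, Complex.real_smul, Complex.sub_re, Complex.re_ofReal_mul]
    ring
  have hone := hsub 1
  rw [Complex.ofReal_one, one_smul] at hone
  have hnonneg := quadForm_nonneg ((δ : ℂ) • u - w) hG
  rw [hsub] at hnonneg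
  have hdiff : (1 - δ)⁻¹ * quadForm (u - w) G + δ⁻¹ * quadForm w G - quadForm u G =
      ((1 - δ) * δ)⁻¹ * (δ ^ 2 * quadForm u G - δ * ((star u ⬝ᵥ (G *ᵥ w)).re +
        (star w ⬝ᵥ (G *ᵥ u)).re) + quadForm w G) := by
    rw [hone]
    field_simp
    ring
  rw [← sub_nonneg, hdiff]
  positivity

theorem kronecker_mulVec_tensorVec {S' T' : Type*} (A : Matrix S' S ℂ) (B : Matrix T' T ℂ)
    (v : S → ℂ) (w : T → ℂ) :
    (A ⊗ₖ B) *ᵥ tensorVec v w = tensorVec (A *ᵥ v) (B *ᵥ w) := by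
  ext p
  simp only [tensorVec, dotProduct, Matrix.mulVec, Fintype.sum_prod_type,
    Matrix.kroneckerMap_apply, Finset.sum_mul_sum, mul_mul_mul_comm]

theorem quadForm_tensorVec_kronecker_one [DecidableEq T] (A : Matrix S S ℂ) (v : S → ℂ)
    (w : T → ℂ) :
    quadForm (tensorVec v w) (A ⊗ₖ 1) = quadForm v A * ∑ t, ‖w t‖ ^ 2 := by
  have hw : star w ⬝ᵥ w = ((∑ t, ‖w t‖ ^ 2 : ℝ) : ℂ) := by
    simp [dotProduct, Complex.conj_mul']
  have hstar : star (tensorVec v w) = tensorVec (star v) (star w) := by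
    ext p
    simp [tensorVec]
  have hdot (v' : S → ℂ) : tensorVec (star v) (star w) ⬝ᵥ tensorVec v' w =
      (star v ⬝ᵥ v') * (star w ⬝ᵥ w) := by
    simp only [tensorVec, dotProduct, Fintype.sum_prod_type, Finset.sum_mul_sum, mul_mul_mul_comm]
  rw [quadForm_apply, kronecker_mulVec_tensorVec, Matrix.one_mulVec, hstar, hdot, hw,
    Complex.re_mul_ofReal, quadForm_apply]

end QuadForm

/-! ### Simulators act on the honest registers only by averaging -/

section PartialTrace

variable {H D : Type*}

/-- The real part of the trace, as a real functional. -/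
def reTrace [Fintype H] : Matrix H H ℂ →ₗ[ℝ] ℝ := Complex.reLm ∘ₗ Matrix.traceLinearMap H ℝ ℂ

theorem reTrace_apply [Fintype H] (G : Matrix H H ℂ) : reTrace G = ∑ a, (G a a).re := by
  simp [reTrace, Matrix.trace]

theorem initialState_posSemidef [Finite H] [Finite D] (ψ : EuclideanSpace ℂ (H × D)) :
    (initialState ψ).PosSemidef :=
  Matrix.posSemidef_vecMulVec_self_star (ψ : H × D → ℂ)

variable [Fintype D]

/-- The partial trace over the second register: the reduced state of the honest party. -/
def partialTrace (σ : Matrix (H × D) (H × D) ℂ) : Matrix H H ℂ :=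
  ∑ y, σ.submatrix (fun x => (x, y)) fun x => (x, y)

theorem partialTrace_apply (σ : Matrix (H × D) (H × D) ℂ) (x x' : H) :
    partialTrace σ x x' = (σ.submatrix (Prod.mk x) (Prod.mk x')).trace := by
  simp [partialTrace, Matrix.sum_apply, Matrix.trace]

theorem partialTrace_posSemidef {σ : Matrix (H × D) (H × D) ℂ} (hσ : σ.PosSemidef) :
    (partialTrace σ).PosSemidef :=
  Matrix.posSemidef_sum _ fun _ _ => hσ.submatrix _

theorem quadForm_partialTrace_initialState [Fintype H] (ψ : EuclideanSpace ℂ (H × D)) (v : H → ℂ) :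
    quadForm v (partialTrace (initialState ψ)) = ‖∑ x, star (v x) • branch ψ x‖ ^ 2 := by
  have hsub (y : D) : (initialState ψ).submatrix (fun x => (x, y)) (fun x => (x, y)) =
      Matrix.vecMulVec (fun x => branch ψ x y) (star fun x => branch ψ x y) :=
    rfl
  simp only [partialTrace, hsub, map_sum, quadForm_vecMulVec_star, EuclideanSpace.norm_sq_eq]
  refine Finset.sum_congr rfl fun y _ => ?_
  rw [← norm_star]
  simp [dotProduct, mul_comm]

theorem partialTrace_initialState_diag_re (ψ : EuclideanSpace ℂ (H × D)) (x : H) :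
    (partialTrace (initialState ψ) x x).re = ‖branch ψ x‖ ^ 2 := by
  simp [partialTrace, Matrix.sum_apply, initialState, branch, EuclideanSpace.norm_sq_eq,
    Complex.mul_conj, Complex.normSq_eq_norm_sq, -Complex.ofReal_pow]

variable [Fintype H] [DecidableEq H]

theorem submatrix_one_kronecker_mul_mul (K : Matrix D D ℂ) (σ : Matrix (H × D) (H × D) ℂ)
    (x x' : H) :
    (((1 : Matrix H H ℂ) ⊗ₖ K) * σ * ((1 : Matrix H H ℂ) ⊗ₖ K)ᴴ).submatrix (Prod.mk x)
      (Prod.mk x') = K * σ.submatrix (Prod.mk x) (Prod.mk x') * Kᴴ := by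
  ext a b
  simp [Matrix.mul_apply, Fintype.sum_prod_type, Matrix.one_apply, apply_ite star]

variable [DecidableEq D]

theorem residual_posSemidef (M : Instrument D) (w : unitInterval)
    {σ : Matrix (H × D) (H × D) ℂ} (hσ : σ.PosSemidef) : (M.residual w σ).PosSemidef :=
  Matrix.posSemidef_sum _ fun _ _ => hσ.mul_mul_conjTranspose_same _

theorem sum_partialTrace_residual (M : Instrument D) (σ : Matrix (H × D) (H × D) ℂ) :
    ∑ w ∈ M.outcomes, partialTrace (M.residual w σ) = partialTrace σ := by
  ext x x'
  have hresidual (w : unitInterval) : partialTrace (M.residual w σ) x x' =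
      ∑ k, ((M.kraus w k)ᴴ * M.kraus w k * σ.submatrix (Prod.mk x) (Prod.mk x')).trace := by
    have hsum : (M.residual w σ).submatrix (Prod.mk x) (Prod.mk x') =
        ∑ k, M.kraus w k * σ.submatrix (Prod.mk x) (Prod.mk x') * (M.kraus w k)ᴴ := by
      simp only [← submatrix_one_kronecker_mul_mul]
      ext a b
      simp only [Instrument.residual, Matrix.submatrix_apply, Matrix.sum_apply]
    rw [partialTrace_apply, hsum, Matrix.trace_sum]
    exact Finset.sum_congr rfl fun k _ => Matrix.trace_mul_cycle _ _ _
  rw [Matrix.sum_apply]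
  simp only [hresidual, ← Matrix.trace_sum, ← Matrix.sum_mul, M.complete, Matrix.one_mul,
    partialTrace_apply]

end PartialTrace

section Simulators

variable {H D : Type*} [Fintype H] [DecidableEq H] [Fintype D] [DecidableEq D] {m : ℕ} {O : Type}

theorem update_residual_posSemidef (M : Instrument D) (w : unitInterval)
    {σ : Fin m → Matrix (H × D) (H × D) ℂ} (hσ : ∀ k, (σ k).PosSemidef) (i k : Fin m) :
    (Function.update σ i (M.residual w (σ i)) k).PosSemidef := by
  rcases eq_or_ne k i with rfl | hk
  · simpa using residual_posSemidef M w (hσ k)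
  · simpa [hk] using hσ k

theorem Simulator.prob_output (F : unitInterval → Instrument D) [DecidableEq O] (o' : O)
    (σ : Fin m → Matrix (H × D) (H × D) ℂ) (x : Fin m → H) (o : O) :
    (Simulator.output o').prob F σ x o =
      if o' = o then ∏ i, (partialTrace (σ i) (x i) (x i)).re else 0 := by
  simp [Simulator.prob, partialTrace_apply, Matrix.trace]

theorem Simulator.prob_nonneg (F : unitInterval → Instrument D) (S : Simulator m O)
    {σ : Fin m → Matrix (H × D) (H × D) ℂ} (hσ : ∀ i, (σ i).PosSemidef) (x : Fin m → H) (o : O) :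
    0 ≤ S.prob F σ x o := by
  classical
  induction S generalizing σ with
  | output o' =>
    rw [Simulator.prob_output]
    split_ifs
    · exact Finset.prod_nonneg fun i _ =>
        (Complex.le_def.1 (partialTrace_posSemidef (hσ i)).diag_nonneg).1
    · exact le_rfl
  | coin p a b iha ihb =>
    exact add_nonneg (mul_nonneg p.2.1 (iha hσ)) (mul_nonneg (sub_nonneg.2 p.2.2) (ihb hσ))
  | query i s next ih =>
    exact Finset.sum_nonneg fun w _ => ih w (update_residual_posSemidef _ w hσ i)

variable [Fintype O]

/-- Each query replaces a reduced state by an ensemble with the same mean, so a multilinear bound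
propagates from the leaves of the simulator to its root. -/
theorem Simulator.sum_prob_mul_le (F : unitInterval → Instrument D) {f : (Fin m → H) → O → ℝ}
    {Λ : MultilinearMap ℝ (fun _ : Fin m => Matrix H H ℂ) ℝ}
    (hf : ∀ G : Fin m → Matrix H H ℂ, (∀ i, (G i).PosSemidef) → ∀ o,
      ∑ x, (∏ i, (G i (x i) (x i)).re) * f x o ≤ Λ G)
    (S : Simulator m O) {σ : Fin m → Matrix (H × D) (H × D) ℂ} (hσ : ∀ i, (σ i).PosSemidef) :
    ∑ x, ∑ o, S.prob F σ x o * f x o ≤ Λ fun i => partialTrace (σ i) := by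
  classical
  induction S generalizing σ with
  | output o' =>
    simpa [Simulator.prob_output] using hf _ (fun i => partialTrace_posSemidef (hσ i)) o'
  | coin p a b iha ihb =>
    calc ∑ x, ∑ o, (Simulator.coin p a b).prob F σ x o * f x o
        = p * ∑ x, ∑ o, a.prob F σ x o * f x o + (1 - p) * ∑ x, ∑ o, b.prob F σ x o * f x o := by
          simp only [Simulator.prob, Finset.mul_sum, ← Finset.sum_add_distrib, add_mul, mul_assoc]
      _ ≤ p * Λ (fun i => partialTrace (σ i)) + (1 - p) * Λ fun i => partialTrace (σ i) :=
          add_le_add (mul_le_mul_of_nonneg_left (iha hσ) p.2.1)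
            (mul_le_mul_of_nonneg_left (ihb hσ) (sub_nonneg.2 p.2.2))
      _ = Λ fun i => partialTrace (σ i) := by ring
  | query i s next ih =>
    have hupdate (τ : Matrix (H × D) (H × D) ℂ) :
        (fun k => partialTrace (Function.update σ i τ k)) =
          Function.update (fun k => partialTrace (σ k)) i (partialTrace τ) :=
      Function.comp_update partialTrace σ i τ
    calc ∑ x, ∑ o, (Simulator.query i s next).prob F σ x o * f x o
        = ∑ w ∈ (F s).outcomes, ∑ x, ∑ o,
            (next w).prob F (Function.update σ i ((F s).residual w (σ i))) x o * f x o := by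
          simp only [Simulator.prob, Finset.sum_mul]
          rw [Finset.sum_congr rfl fun x _ => Finset.sum_comm, Finset.sum_comm]
      _ ≤ ∑ w ∈ (F s).outcomes,
            Λ fun k => partialTrace (Function.update σ i ((F s).residual w (σ i)) k) :=
          Finset.sum_le_sum fun w _ => ih w (update_residual_posSemidef _ w hσ i)
      _ = Λ fun k => partialTrace (σ k) := by
          simp only [hupdate]
          rw [← Λ.map_update_sum, sum_partialTrace_residual, Function.update_eq_self]

theorem Simulator.sum_prob_le (F : unitInterval → Instrument D) (S : Simulator m O)
    {σ : Fin m → Matrix (H × D) (H × D) ℂ} (hσ : ∀ i, (σ i).PosSemidef) (x : Fin m → H) :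
    ∑ o, S.prob F σ x o ≤ ∏ i, (partialTrace (σ i) (x i) (x i)).re := by
  classical
  have h := S.sum_prob_mul_le F (f := fun x' _ => if x' = x then 1 else 0)
    (Λ := (MultilinearMap.mkPiAlgebra ℝ (Fin m) ℝ).compLinearMap
      fun i => quadForm (Pi.single (x i) 1)) (fun G _ _ => by simp [quadForm_single]) hσ
  simpa [quadForm_single, Finset.sum_ite_irrel] using h

theorem Simulator.sum_prob_mul_pair_le (F : unitInterval → Instrument D) {i j : Fin m}
    (hij : i ≠ j) {g : H → H → O → ℝ} {κ : Matrix H H ℂ →ₗ[ℝ] ℝ}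
    (hκ : ∀ A B : Matrix H H ℂ, A.PosSemidef → B.PosSemidef → ∀ o,
      ∑ a, ∑ b, (A a a).re * (B b b).re * g a b o ≤ κ A * κ B)
    (S : Simulator m O) {σ : Fin m → Matrix (H × D) (H × D) ℂ} (hσ : ∀ k, (σ k).PosSemidef) :
    ∑ x, ∑ o, S.prob F σ x o * g (x i) (x j) o ≤
      κ (partialTrace (σ i)) * κ (partialTrace (σ j)) *
        ∏ k : {k // k ≠ i ∧ k ≠ j}, reTrace (partialTrace (σ k)) := by
  set l : Fin m → Matrix H H ℂ →ₗ[ℝ] ℝ := fun k => if k = i ∨ k = j then κ else reTrace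
  have hl (G : Fin m → Matrix H H ℂ) : ∏ k, l k (G k) =
      κ (G i) * κ (G j) * ∏ k : {k // k ≠ i ∧ k ≠ j}, reTrace (G k) := by
    rw [prod_eq_mul_mul_prod_subtype hij]
    simp only [l, true_or, or_true, if_true]
    exact congrArg _ (Finset.prod_congr rfl fun k _ => by rw [if_neg (not_or.2 k.2)])
  rw [← hl fun k => partialTrace (σ k)]
  refine S.sum_prob_mul_le F (f := fun x o => g (x i) (x j) o)
    (Λ := (MultilinearMap.mkPiAlgebra ℝ (Fin m) ℝ).compLinearMap l) (fun G hG o => ?_) hσ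
  rw [MultilinearMap.compLinearMap_apply, MultilinearMap.mkPiAlgebra_apply, hl,
    sum_prod_mul_pair hij (fun k a => (G k a a).re) (fun a b => g a b o)]
  simp only [reTrace_apply]
  exact mul_le_mul_of_nonneg_right (hκ _ _ (hG i) (hG j) o) (Finset.prod_nonneg fun k _ =>
    Finset.sum_nonneg fun a _ => (Complex.le_def.1 (hG k).diag_nonneg).1)

end Simulators

/-! ### Unambiguous comparison of two states -/

section POVMs

variable {S T O : Type*} [Fintype S] [DecidableEq S] [Fintype T] [DecidableEq T] [Fintype O]

/-- The trivial POVM, whose outcome is always `o₀`. -/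
def POVM.const [DecidableEq O] (o₀ : O) : POVM S O where
  elem o := if o = o₀ then 1 else 0
  posSemidef o := by
    split_ifs
    · exact Matrix.PosSemidef.one
    · exact Matrix.PosSemidef.zero
  sum_eq_one := by simp

/-- The POVM `E` under an identification of the computational bases. -/
def POVM.reindex (E : POVM T O) (e : S ≃ T) : POVM S O where
  elem o := (E.elem o).submatrix e e
  posSemidef o := (E.posSemidef o).submatrix e
  sum_eq_one := by
    have h := congrArg (Matrix.reindexAlgEquiv ℂ ℂ e.symm) E.sum_eq_one
    rwa [map_sum, map_one] at h

/-- The POVM `E` applied to the first of two registers. -/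
def POVM.tensorOne (E : POVM S O) (T : Type*) [Fintype T] [DecidableEq T] : POVM (S × T) O where
  elem o := E.elem o ⊗ₖ 1
  posSemidef o := (E.posSemidef o).kronecker Matrix.PosSemidef.one
  sum_eq_one := by
    rw [← Matrix.one_kronecker_one, ← E.sum_eq_one]
    ext p q
    simp [Matrix.sum_apply, Finset.sum_mul]

/-- A POVM on two registers, applied to the registers `i` and `j` of several. -/
def POVM.onPair {ι : Type*} [Fintype ι] [DecidableEq ι] (E : POVM (S × S) O) {i j : ι}
    (hij : i ≠ j) : POVM (ι → S) O :=
  (E.tensorOne _).reindex (pairEquiv hij)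

theorem attackProb_onPair {H : Type*} {m : ℕ} (ψ : EuclideanSpace ℂ (H × S)) (E : POVM (S × S) O)
    {i j : Fin m} (hij : i ≠ j) (x : Fin m → H) (o : O) :
    attackProb ψ (E.onPair hij) x o =
      quadForm (tensorVec (branch ψ (x i)) (branch ψ (x j))) (E.elem o) *
        ∏ k : {k // k ≠ i ∧ k ≠ j}, ‖branch ψ (x k)‖ ^ 2 := by
  have hresidual : residualVector ψ x = tensorVec (tensorVec (branch ψ (x i)) (branch ψ (x j)))
      (fun z => ∏ k : {k // k ≠ i ∧ k ≠ j}, branch ψ (x k) (z k)) ∘ pairEquiv hij := by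
    ext y
    exact prod_eq_mul_mul_prod_subtype hij fun k => ψ (x k, y k)
  change quadForm (residualVector ψ x) ((E.elem o ⊗ₖ 1).submatrix _ _) = _
  rw [hresidual, quadForm_submatrix_equiv, quadForm_tensorVec_kronecker_one]
  simp only [norm_prod, ← Finset.prod_pow, EuclideanSpace.norm_sq_eq, Fintype.prod_sum]

/-- The POVM `E` transported along an isometry `B`; the orthogonal complement of the range of `B`
goes to the outcome `o₀`. -/
def POVM.extend [DecidableEq O] (E : POVM T O) (B : Matrix S T ℂ) (hB : Bᴴ * B = 1) (o₀ : O) :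
    POVM S O where
  elem o := B * E.elem o * Bᴴ + if o = o₀ then 1 - B * Bᴴ else 0
  posSemidef o := by
    have hproj : B * Bᴴ * (B * Bᴴ) = B * Bᴴ := by
      rw [Matrix.mul_assoc, ← Matrix.mul_assoc Bᴴ, hB, Matrix.one_mul]
    have hcompl : 1 - B * Bᴴ = (1 - B * Bᴴ)ᴴ * (1 - B * Bᴴ) := by
      simp [Matrix.conjTranspose_sub, Matrix.mul_sub, Matrix.sub_mul, hproj]
    refine ((E.posSemidef o).mul_mul_conjTranspose_same B).add ?_
    split_ifs
    · exact hcompl ▸ Matrix.posSemidef_conjTranspose_mul_self _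
    · exact Matrix.PosSemidef.zero
  sum_eq_one := by
    rw [Finset.sum_add_distrib, ← Matrix.sum_mul, ← Matrix.mul_sum, E.sum_eq_one]
    simp

theorem POVM.quadForm_extend [DecidableEq O] (E : POVM T O) (B : Matrix S T ℂ) (hB : Bᴴ * B = 1)
    (o₀ o : O) (u : T → ℂ) :
    quadForm (B *ᵥ u) ((E.extend B hB o₀).elem o) = quadForm u (E.elem o) := by
  have hcompl : (1 - B * Bᴴ) *ᵥ (B *ᵥ u) = 0 := by
    rw [Matrix.mulVec_mulVec, Matrix.sub_mul, Matrix.mul_assoc, hB, Matrix.mul_one,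
      Matrix.one_mul, sub_self, Matrix.zero_mulVec]
  have hzero : quadForm (B *ᵥ u) (if o = o₀ then 1 - B * Bᴴ else 0) = 0 := by
    split_ifs
    · rw [quadForm_apply, hcompl, dotProduct_zero, Complex.zero_re]
    · exact map_zero _
  simp only [POVM.extend]
  rw [map_add, hzero, add_zero, quadForm_mul_mul_conjTranspose, Matrix.mulVec_mulVec, hB,
    Matrix.one_mulVec]

end POVMs

section Qubits

/-- The sign `1` or `-1` that encodes a bit. -/
def boolSign (e : Bool) : ℝ := if e then 1 else -1

/-- Two unit vectors of `ℂ²` with overlap `s`, placed symmetrically about the first axis. -/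
def qubitVec (s : ℝ) (e : Bool) : Fin 2 → ℂ :=
  ![((√((1 + s) / 2) : ℝ) : ℂ), ((boolSign e * √((1 - s) / 2) : ℝ) : ℂ)]

/-- The vector `|01⟩ ± |10⟩`. For the sign `-` it is orthogonal to equal qubit states, for the sign
`+` to different ones of the form `qubitVec s`. -/
def oddVec (e : Bool) : Fin 2 × Fin 2 → ℂ :=
  fun p => ((!![0, 1; boolSign e, 0] : Matrix (Fin 2) (Fin 2) ℝ) p.1 p.2 : ℝ)

/-- The vector `r|00⟩ ± |11⟩`. With `r = (1 - s) / (1 + s)` it has for the sign `-` no overlap with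
equal states, and for the sign `+` no overlap with different states of the form `qubitVec s`. -/
def evenVec (r : ℝ) (e : Bool) : Fin 2 × Fin 2 → ℂ :=
  fun p => ((!![r, 0; 0, boolSign e] : Matrix (Fin 2) (Fin 2) ℝ) p.1 p.2 : ℝ)

/-- The unambiguous comparison of two qubits: outcome `some true` for "equal", `some false` for
"different" and `none` for "don't know". -/
def qubitComparison (r : ℝ) (hr : r ^ 2 ≤ 1) : POVM (Fin 2 × Fin 2) (Option Bool) where
  elem
    | none => (1 - r ^ 2 : ℝ) •
        Matrix.vecMulVec (Pi.single (0, 0) (1 : ℂ)) (star (Pi.single (0, 0) (1 : ℂ)))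
    | some e => (1 / 2 : ℝ) • (Matrix.vecMulVec (oddVec e) (star (oddVec e)) +
        Matrix.vecMulVec (evenVec r e) (star (evenVec r e)))
  posSemidef
    | none => (Matrix.posSemidef_vecMulVec_self_star _).smul (sub_nonneg.2 hr)
    | some _ => ((Matrix.posSemidef_vecMulVec_self_star _).add
        (Matrix.posSemidef_vecMulVec_self_star _)).smul (by norm_num : (0 : ℝ) ≤ 1 / 2)
  sum_eq_one := by
    ext ⟨a, b⟩ ⟨a', b'⟩
    rw [Matrix.sum_apply]
    simp only [Fintype.sum_option, Fintype.sum_bool, Matrix.smul_apply, Matrix.add_apply,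
      Matrix.vecMulVec_apply, Pi.star_apply, oddVec, evenVec, boolSign, Matrix.one_apply]
    fin_cases a <;> fin_cases b <;> fin_cases a' <;> fin_cases b' <;>
      simp <;> ring

theorem star_oddVec_dotProduct (s : ℝ) (a b e : Bool) :
    star (oddVec e) ⬝ᵥ tensorVec (qubitVec s a) (qubitVec s b) =
      (((boolSign b + boolSign e * boolSign a) * (√((1 + s) / 2) * √((1 - s) / 2)) : ℝ) : ℂ) := by
  simp only [dotProduct, Fintype.sum_prod_type, Fin.sum_univ_two, oddVec, qubitVec, tensorVec,
    Pi.star_apply, RCLike.star_def, Complex.conj_ofReal, Matrix.of_apply, Matrix.cons_val',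
    Matrix.cons_val_zero, Matrix.cons_val_one, Matrix.cons_val_fin_one]
  push_cast
  ring

theorem star_evenVec_dotProduct {s r : ℝ} (hs₀ : -1 ≤ s) (hs₁ : s ≤ 1) (hr : r * (1 + s) = 1 - s)
    (a b e : Bool) :
    star (evenVec r e) ⬝ᵥ tensorVec (qubitVec s a) (qubitVec s b) =
      (((1 + boolSign e * boolSign a * boolSign b) * ((1 - s) / 2) : ℝ) : ℂ) := by
  have hsq_add : √((1 + s) / 2) ^ 2 = (1 + s) / 2 := Real.sq_sqrt (by linarith)
  have hsq_sub : √((1 - s) / 2) ^ 2 = (1 - s) / 2 := Real.sq_sqrt (by linarith)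
  calc star (evenVec r e) ⬝ᵥ tensorVec (qubitVec s a) (qubitVec s b)
      = ((r * √((1 + s) / 2) ^ 2 +
          boolSign e * boolSign a * boolSign b * √((1 - s) / 2) ^ 2 : ℝ) : ℂ) := by
        simp only [dotProduct, Fintype.sum_prod_type, Fin.sum_univ_two, evenVec, qubitVec,
          tensorVec, Pi.star_apply, RCLike.star_def, Complex.conj_ofReal, Matrix.of_apply,
          Matrix.cons_val', Matrix.cons_val_zero, Matrix.cons_val_one, Matrix.cons_val_fin_one]
        push_cast
        ring
    _ = (((1 + boolSign e * boolSign a * boolSign b) * ((1 - s) / 2) : ℝ) : ℂ) := by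
        rw [hsq_add, hsq_sub]
        congr 1
        linear_combination hr / 2

theorem quadForm_qubitComparison {s r : ℝ} (hs₀ : -1 ≤ s) (hs₁ : s ≤ 1) (hr : r ^ 2 ≤ 1)
    (hrs : r * (1 + s) = 1 - s) (a b e : Bool) :
    quadForm (tensorVec (qubitVec s a) (qubitVec s b)) ((qubitComparison r hr).elem (some e)) =
      if e = decide (a = b) then 1 - s else 0 := by
  have hsq_add : √((1 + s) / 2) ^ 2 = (1 + s) / 2 := Real.sq_sqrt (by linarith)
  have hsq_sub : √((1 - s) / 2) ^ 2 = (1 - s) / 2 := Real.sq_sqrt (by linarith)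
  calc quadForm (tensorVec (qubitVec s a) (qubitVec s b)) ((qubitComparison r hr).elem (some e))
      = 1 / 2 * (((boolSign b + boolSign e * boolSign a) *
          (√((1 + s) / 2) * √((1 - s) / 2))) ^ 2 +
          ((1 + boolSign e * boolSign a * boolSign b) * ((1 - s) / 2)) ^ 2) := by
        simp only [qubitComparison, map_smul, map_add, quadForm_vecMulVec_star,
          star_oddVec_dotProduct, star_evenVec_dotProduct hs₀ hs₁ hrs, Complex.norm_real,
          Real.norm_eq_abs, sq_abs, smul_eq_mul]
    _ = 1 / 2 * ((boolSign b + boolSign e * boolSign a) ^ 2 * ((1 + s) / 2 * ((1 - s) / 2)) +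
          ((1 + boolSign e * boolSign a * boolSign b) * ((1 - s) / 2)) ^ 2) := by
        rw [mul_pow, mul_pow (√_), hsq_add, hsq_sub]
    _ = if e = decide (a = b) then 1 - s else 0 := by
        cases a <;> cases b <;> cases e <;> simp [boolSign] <;> ring

end Qubits

section Comparison

variable {Y : Type*} [Fintype Y]

/-- The columns of the isometry are the normalised sum and difference of the two vectors. -/
theorem exists_isometry_of_inner_eq {p q : ℝ} (hp : p ≠ 0) (hq : q ≠ 0) (hpq : p ^ 2 + q ^ 2 = 1)
    {u v : EuclideanSpace ℂ Y} (hu : ‖u‖ = 1) (hv : ‖v‖ = 1)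
    (huv : inner ℂ u v = ((p ^ 2 - q ^ 2 : ℝ) : ℂ)) :
    ∃ V : Matrix Y (Fin 2) ℂ, Vᴴ * V = 1 ∧ V *ᵥ ![(p : ℂ), q] = u ∧ V *ᵥ ![(p : ℂ), -q] = v := by
  have huu : inner ℂ u u = (1 : ℂ) := by simp [inner_self_eq_norm_sq_to_K, hu]
  have hvv : inner ℂ v v = (1 : ℂ) := by simp [inner_self_eq_norm_sq_to_K, hv]
  have hvu : inner ℂ v u = ((p ^ 2 - q ^ 2 : ℝ) : ℂ) := by
    rw [← inner_conj_symm, huv, Complex.conj_ofReal]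
  have hp' : (p : ℂ) ≠ 0 := Complex.ofReal_ne_zero.2 hp
  have hq' : (q : ℂ) ≠ 0 := Complex.ofReal_ne_zero.2 hq
  have hpq' : (p : ℂ) ^ 2 + (q : ℂ) ^ 2 = 1 := by exact_mod_cast hpq
  let W : Fin 2 → EuclideanSpace ℂ Y := ![(2 * p : ℂ)⁻¹ • (u + v), (2 * q : ℂ)⁻¹ • (u - v)]
  have hW : Matrix.gram ℂ W = 1 := by
    ext k l
    fin_cases k <;> fin_cases l <;>
      simp only [W, Matrix.gram_apply, Fin.zero_eta, Fin.mk_one, Matrix.cons_val_zero,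
        Matrix.cons_val_one, inner_smul_left, inner_smul_right, inner_add_left, inner_add_right,
        inner_sub_left, inner_sub_right, huu, hvv, huv, hvu, Matrix.one_apply, map_inv₀, map_mul,
        map_ofNat, Complex.conj_ofReal] <;>
      push_cast <;> field_simp
    · linear_combination -2 * hpq'
    · ring
    · ring
    · linear_combination -2 * hpq'
  refine ⟨Matrix.of fun y k => W k y, ?_, ?_, ?_⟩
  · rw [← hW]
    ext k l
    simp [Matrix.mul_apply, Matrix.gram_apply, PiLp.inner_apply, mul_comm]
  all_goals
    ext y
    simp only [Matrix.mulVec, dotProduct, Matrix.of_apply, Fin.sum_univ_two, Matrix.cons_val_zero,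
      Matrix.cons_val_one, Matrix.cons_val_fin_one, PiLp.add_apply, PiLp.sub_apply,
      PiLp.smul_apply, smul_eq_mul, W]
    field_simp
    ring

theorem exists_isometry_qubitVec {s : ℝ} (hs₀ : -1 < s) (hs₁ : s < 1)
    {u : Bool → EuclideanSpace ℂ Y} (hu : ∀ e, ‖u e‖ = 1)
    (hinner : inner ℂ (u true) (u false) = s) :
    ∃ V : Matrix Y (Fin 2) ℂ, Vᴴ * V = 1 ∧ ∀ e, V *ᵥ qubitVec s e = u e := by
  have hsq_add : √((1 + s) / 2) ^ 2 = (1 + s) / 2 := Real.sq_sqrt (by linarith)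
  have hsq_sub : √((1 - s) / 2) ^ 2 = (1 - s) / 2 := Real.sq_sqrt (by linarith)
  obtain ⟨V, hV, htrue, hfalse⟩ := exists_isometry_of_inner_eq
    (Real.sqrt_pos.2 (by linarith : 0 < (1 + s) / 2)).ne'
    (Real.sqrt_pos.2 (by linarith : 0 < (1 - s) / 2)).ne'
    (by rw [hsq_add, hsq_sub]; ring) (hu true) (hu false)
    (by rw [hinner, hsq_add, hsq_sub]; ring_nf)
  refine ⟨V, hV, fun e => ?_⟩
  cases e
  · simpa only [qubitVec, boolSign, Bool.false_eq_true, if_false, neg_one_mul, Complex.ofReal_neg]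
      using hfalse
  · simpa only [qubitVec, boolSign, if_true, one_mul] using htrue

/-- Multiplying one of the vectors by a phase, one may assume that their inner product is `s`. -/
theorem exists_unambiguousComparison [DecidableEq Y] {u : Bool → EuclideanSpace ℂ Y}
    (hu : ∀ e, ‖u e‖ = 1) {s : ℝ} (hs : ‖inner ℂ (u true) (u false)‖ = s) (hs₁ : s < 1) :
    ∃ E : POVM (Y × Y) (Option Bool), ∀ a b e,
      quadForm (tensorVec (u a) (u b)) (E.elem (some e)) =
        if e = decide (a = b) then 1 - s else 0 := by
  have hs₀ : 0 ≤ s := hs ▸ norm_nonneg _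
  obtain ⟨ω, hω, hωs⟩ := Complex.exists_norm_eq_mul_self (inner ℂ (u true) (u false))
  rw [hs] at hωs
  have hω₀ : ω ≠ 0 := norm_ne_zero_iff.1 (hω ▸ one_ne_zero)
  obtain ⟨V, hV, hVu⟩ := exists_isometry_qubitVec (u := fun e => (if e then 1 else ω) • u e)
    (by linarith : -1 < s) hs₁ (fun e => by cases e <;> simp [norm_smul, hω, hu])
    (by simp [hωs])
  have hVV : (V ⊗ₖ V)ᴴ * (V ⊗ₖ V) = 1 := by
    rw [Matrix.conjTranspose_kronecker, ← Matrix.mul_kronecker_mul, hV, Matrix.one_kronecker_one]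
  have hr : ((1 - s) / (1 + s)) ^ 2 ≤ 1 := by
    rw [sq_le_one_iff_abs_le_one, abs_of_nonneg (div_nonneg (by linarith) (by linarith)),
      div_le_one (by linarith)]
    linarith
  have hphase (e : Bool) : ∃ γ : ℂ, ‖γ‖ = 1 ∧ (u e : Y → ℂ) = γ • (V *ᵥ qubitVec s e) := by
    refine ⟨(if e then 1 else ω)⁻¹, by cases e <;> simp [hω], ?_⟩
    rw [hVu]
    cases e <;> simp [hω₀]
  refine ⟨(qubitComparison _ hr).extend (V ⊗ₖ V) hVV none, fun a b e => ?_⟩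
  obtain ⟨γ, hγ, hγu⟩ := hphase a
  obtain ⟨δ, hδ, hδu⟩ := hphase b
  rw [hγu, hδu, tensorVec_smul_smul, quadForm_smul, norm_mul, hγ, hδ, one_mul, one_pow, one_mul,
    ← kronecker_mulVec_tensorVec, POVM.quadForm_extend,
    quadForm_qubitComparison (by linarith) hs₁.le hr (div_mul_cancel₀ _ (by linarith))]

theorem exists_attackProb_eq_comparison {X : Type*} [DecidableEq X] [DecidableEq Y]
    {P : X × Y → ℝ} {ψ : EuclideanSpace ℂ (X × Y)} (hψ : IsRegularEmbedding P ψ) {x₀ x₁ : X}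
    (h₀ : 0 < marginal P x₀) (h₁ : 0 < marginal P x₁) {s : ℝ}
    (hs : ‖inner ℂ (condState P ψ x₀) (condState P ψ x₁)‖ = s) (hs₁ : s < 1) {m : ℕ} {i j : Fin m}
    (hij : i ≠ j) :
    ∃ E : POVM (Fin m → Y) (Option Bool), ∀ x : Fin m → X, (x i = x₀ ∨ x i = x₁) →
      (x j = x₀ ∨ x j = x₁) → ∀ e, attackProb ψ E x (some e) =
        (if e = decide (x i = x j) then 1 - s else 0) * ∏ k, marginal P (x k) := by
  have hne : x₀ ≠ x₁ := by
    rintro rfl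
    simp [inner_self_eq_norm_sq_to_K, norm_condState hψ h₀] at hs
    exact hs₁.ne hs.symm
  let u (e : Bool) : EuclideanSpace ℂ Y := condState P ψ (if e then x₀ else x₁)
  obtain ⟨E, hE⟩ := exists_unambiguousComparison (u := u)
    (fun e => by cases e <;> simp [u, norm_condState hψ, h₀, h₁]) hs hs₁
  have hbranch (a : X) (ha : a = x₀ ∨ a = x₁) :
      (branch ψ a : Y → ℂ) = ((√(marginal P a) : ℝ) : ℂ) • (u (decide (a = x₀)) : Y → ℂ) := by
    rcases ha with rfl | rfl
    · simp [u, branch_eq_smul_condState h₀]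
    · simp [u, hne.symm, branch_eq_smul_condState h₁]
  refine ⟨E.onPair hij, fun x hi hj e => ?_⟩
  have hdecide : decide (decide (x i = x₀) = decide (x j = x₀)) = decide (x i = x j) := by
    rcases hi with hi | hi <;> rcases hj with hj | hj <;> simp [hi, hj, hne, hne.symm]
  rw [attackProb_onPair, hbranch _ hi, hbranch _ hj, tensorVec_smul_smul, quadForm_smul, hE,
    hdecide, prod_eq_mul_mul_prod_subtype hij]
  simp only [norm_branch_sq hψ, norm_mul, Complex.norm_real, Real.norm_eq_abs, mul_pow, sq_abs,
    Real.sq_sqrt (marginal_nonneg hψ _)]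
  ring

end Comparison

/-! ### Concentration of the number of pairs of positions -/

section IidMean

variable {X ι : Type*} [Fintype X] [Fintype ι] [DecidableEq ι] {q : X → ℝ}

/-- The expectation of a function of `x : ι → X` whose coordinates are drawn independently with
probabilities `q`. -/
def iidMean (q : X → ℝ) : ((ι → X) → ℝ) →ₗ[ℝ] ℝ :=
  Fintype.linearCombination ℝ fun x => ∏ k, q (x k)

theorem iidMean_apply (q : X → ℝ) (f : (ι → X) → ℝ) :
    iidMean q f = ∑ x, (∏ k, q (x k)) * f x := by
  simp only [iidMean, Fintype.linearCombination_apply, smul_eq_mul, mul_comm]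

theorem iidMean_mono (hq : ∀ a, 0 ≤ q a) {f g : (ι → X) → ℝ} (hfg : ∀ x, f x ≤ g x) :
    iidMean q f ≤ iidMean q g := by
  simp only [iidMean_apply]
  exact Finset.sum_le_sum fun x _ =>
    mul_le_mul_of_nonneg_left (hfg x) (Finset.prod_nonneg fun k _ => hq (x k))

theorem sum_prod_eq_one (hq : ∑ a, q a = 1) : ∑ x : ι → X, ∏ k, q (x k) = 1 := by
  rw [← Fintype.prod_sum, hq, Finset.prod_const_one]

theorem iidMean_const (hq : ∑ a, q a = 1) (c : ℝ) : iidMean q (fun _ : ι → X => c) = c := by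
  rw [iidMean_apply, ← Finset.sum_mul, sum_prod_eq_one hq, one_mul]

theorem iidMean_pair (hq : ∑ a, q a = 1) {i j : ι} (hij : i ≠ j) (g : X → X → ℝ) :
    iidMean q (fun x => g (x i) (x j)) = ∑ a, ∑ b, q a * q b * g a b := by
  rw [iidMean_apply, sum_prod_mul_pair hij (fun _ => q) g, hq, Finset.prod_const_one, mul_one]

theorem iidMean_abs_le_sqrt (hq : ∀ a, 0 ≤ q a) (hq₁ : ∑ a, q a = 1) (f : (ι → X) → ℝ) :
    iidMean q (fun x => |f x|) ≤ √(iidMean q fun x => f x ^ 2) := by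
  refine Real.le_sqrt_of_sq_le ?_
  simp only [iidMean_apply, ← sq_abs (f _)]
  exact Real.pow_arith_mean_le_arith_mean_pow_of_even _ _ _
    (fun x _ => Finset.prod_nonneg fun k _ => hq (x k)) (sum_prod_eq_one hq₁) even_two

theorem iidMean_sum_sq_le (hq : ∀ a, 0 ≤ q a) (hq₁ : ∑ a, q a = 1) {f : X → ℝ}
    (hf : ∑ a, q a * f a = 0) (hf₁ : ∀ a, |f a| ≤ 1) :
    iidMean q (fun x : ι → X => (∑ i, f (x i)) ^ 2) ≤ Fintype.card ι := by
  have hoff {i j : ι} (hij : i ≠ j) : iidMean q (fun x : ι → X => f (x i) * f (x j)) = 0 := by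
    calc iidMean q (fun x : ι → X => f (x i) * f (x j)) = ∑ a, ∑ b, q a * q b * (f a * f b) :=
          iidMean_pair hq₁ hij fun a b => f a * f b
      _ = (∑ a, q a * f a) * ∑ b, q b * f b := by
          simp only [Finset.sum_mul_sum, mul_mul_mul_comm (q _) (q _)]
      _ = 0 := by rw [hf, zero_mul]
  have hdiag (i : ι) : iidMean q (fun x : ι → X => f (x i) * f (x i)) ≤ 1 := by
    refine (iidMean_mono hq fun x => ?_).trans_eq (iidMean_const hq₁ 1)
    rw [← sq]
    exact (sq_le_one_iff_abs_le_one _).2 (hf₁ _)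
  have hexpand : (fun x : ι → X => (∑ i, f (x i)) ^ 2) =
      ∑ i, ∑ j, fun x => f (x i) * f (x j) := by
    ext x
    simp only [sq, Finset.sum_mul_sum, Finset.sum_apply]
  calc iidMean q (fun x : ι → X => (∑ i, f (x i)) ^ 2)
      = ∑ i, ∑ j, iidMean q (fun x : ι → X => f (x i) * f (x j)) := by
        simp only [hexpand, map_sum]
    _ = ∑ i, iidMean q (fun x : ι → X => f (x i) * f (x i)) :=
        Finset.sum_congr rfl fun i _ => Fintype.sum_eq_single i fun j hj => hoff hj.symm
    _ ≤ ∑ _i : ι, 1 := Finset.sum_le_sum fun i _ => hdiag i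
    _ = Fintype.card ι := by simp

end IidMean

section Deviation

variable {X : Type*} [DecidableEq X] {m : ℕ}

/-- The relative frequency of `α` in `x`. -/
def frequency (x : Fin m → X) (α : X) : ℝ := (∑ i, if x i = α then 1 else 0) / m

theorem frequency_nonneg (x : Fin m → X) (α : X) : 0 ≤ frequency x α :=
  div_nonneg (Finset.sum_nonneg fun i _ => by split_ifs <;> norm_num) m.cast_nonneg

theorem frequency_le_one (x : Fin m → X) (α : X) : frequency x α ≤ 1 := by
  refine div_le_one_of_le₀ ?_ m.cast_nonneg
  calc ∑ i, (if x i = α then (1 : ℝ) else 0) ≤ ∑ _i : Fin m, 1 :=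
        Finset.sum_le_sum fun i _ => by split_ifs <;> norm_num
    _ = m := by simp

theorem iidMean_abs_frequency_sub_le [Fintype X] (hm : 0 < m) {q : X → ℝ} (hq : ∀ a, 0 ≤ q a)
    (hq₁ : ∑ a, q a = 1) (α : X) :
    iidMean q (fun x : Fin m → X => |frequency x α - q α|) ≤ 1 / √m := by
  have hm' : (0 : ℝ) < m := Nat.cast_pos.2 hm
  have hqα : q α ≤ 1 := hq₁ ▸ Finset.single_le_sum (fun a _ => hq a) (Finset.mem_univ α)
  let f (a : X) : ℝ := (if a = α then 1 else 0) - q α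
  have hmean : ∑ a, q a * f a = 0 := by
    simp [f, mul_sub, ← Finset.sum_mul, hq₁]
  have hf (a : X) : |f a| ≤ 1 := by
    have := hq α
    simp only [f, abs_le]
    split_ifs <;> constructor <;> linarith
  have hdev : (fun x : Fin m → X => (frequency x α - q α) ^ 2) =
      ((m : ℝ) ^ 2)⁻¹ • fun x => (∑ i, f (x i)) ^ 2 := by
    ext x
    simp only [frequency, f, Finset.sum_sub_distrib, Finset.sum_const, Finset.card_univ,
      Fintype.card_fin, nsmul_eq_mul, Pi.smul_apply, smul_eq_mul]
    field_simp
  calc iidMean q (fun x : Fin m → X => |frequency x α - q α|)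
      ≤ √(iidMean q fun x : Fin m → X => (frequency x α - q α) ^ 2) := iidMean_abs_le_sqrt hq hq₁ _
    _ ≤ √(((m : ℝ) ^ 2)⁻¹ * m) := by
        rw [hdev, map_smul, smul_eq_mul]
        gcongr
        simpa using iidMean_sum_sq_le (ι := Fin m) hq hq₁ hmean hf
    _ = 1 / √m := by
        rw [sq, mul_inv, inv_mul_cancel_right₀ hm'.ne', Real.sqrt_inv, one_div]

theorem abs_card_pairPositions_div_sub_le (x : Fin m → X) (α β : X) :
    |(pairPositions x α β).card / (m : ℝ) ^ 2 - frequency x α * frequency x β| ≤ 1 / m := by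
  have hcard : ((pairPositions x α β).card : ℝ) =
      ∑ i, ∑ j, if i ≠ j ∧ x i = α ∧ x j = β then 1 else 0 := by
    rw [pairPositions, Finset.card_filter, Fintype.sum_prod_type]
    push_cast
    rfl
  have hterm (i : Fin m) : |∑ j, ((if i ≠ j ∧ x i = α ∧ x j = β then (1 : ℝ) else 0) -
      (if x i = α then 1 else 0) * if x j = β then 1 else 0)| ≤ 1 := by
    rw [Fintype.sum_eq_single i]
    · split_ifs <;> simp_all
    · intro j hj
      by_cases hi : x i = α <;> simp [hi, hj.symm]
  rw [frequency, frequency, div_mul_div_comm, ← sq, ← sub_div, hcard, Finset.sum_mul_sum,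
    ← Finset.sum_sub_distrib, abs_div, abs_of_nonneg (sq_nonneg (m : ℝ))]
  simp only [← Finset.sum_sub_distrib]
  calc _ ≤ (∑ _i : Fin m, 1) / (m : ℝ) ^ 2 := by
        gcongr
        exact (Finset.abs_sum_le_sum_abs _ _).trans (Finset.sum_le_sum fun i _ => hterm i)
    _ = 1 / m := by simp [sq, div_self_mul_self']

/-- The relative deviation of the number of pairs of positions from `m² q(α) q(β)`, which is about
its mean. -/
def pairDeviation (q : X → ℝ) (x : Fin m → X) (α β : X) : ℝ :=
  |(pairPositions x α β).card / (m ^ 2 * (q α * q β)) - 1|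

theorem pairDeviation_nonneg (q : X → ℝ) (x : Fin m → X) (α β : X) :
    0 ≤ pairDeviation q x α β :=
  abs_nonneg _

theorem pairDeviation_le {q : X → ℝ} {α β : X} (hα : 0 < q α) (hβ : 0 < q β) (hβ₁ : q β ≤ 1)
    (x : Fin m → X) :
    pairDeviation q x α β ≤
      (q α * q β)⁻¹ * (1 / m + (|frequency x α - q α| + |frequency x β - q β|)) := by
  have hpos : 0 < q α * q β := mul_pos hα hβ
  have hfreq : |frequency x α * frequency x β - q α * q β| ≤
      |frequency x α - q α| + |frequency x β - q β| := by
    calc _ = |(frequency x α - q α) * q β + frequency x α * (frequency x β - q β)| := by ring_nf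
      _ ≤ |frequency x α - q α| * q β + frequency x α * |frequency x β - q β| := by
        refine (abs_add_le _ _).trans_eq ?_
        rw [abs_mul, abs_mul, abs_of_pos hβ, abs_of_nonneg (frequency_nonneg x α)]
      _ ≤ |frequency x α - q α| + |frequency x β - q β| :=
        add_le_add (mul_le_of_le_one_right (abs_nonneg _) hβ₁)
          (mul_le_of_le_one_left (abs_nonneg _) (frequency_le_one x α))
  calc pairDeviation q x α β
      = (q α * q β)⁻¹ * |(pairPositions x α β).card / (m : ℝ) ^ 2 - q α * q β| := by
        rw [pairDeviation, ← abs_of_pos (inv_pos.2 hpos), ← abs_mul, mul_sub,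
          inv_mul_cancel₀ hpos.ne', ← div_div, div_eq_inv_mul _ (q α * q β)]
    _ ≤ _ := by
        gcongr
        exact (abs_sub_le _ _ _).trans
          (add_le_add (abs_card_pairPositions_div_sub_le x α β) hfreq)

theorem iidMean_pairDeviation_le [Fintype X] (hm : 0 < m) {q : X → ℝ} (hq : ∀ a, 0 ≤ q a)
    (hq₁ : ∑ a, q a = 1) {α β : X} (hα : 0 < q α) (hβ : 0 < q β) :
    iidMean q (fun x : Fin m → X => pairDeviation q x α β) ≤
      (q α * q β)⁻¹ * (1 / m + (1 / √m + 1 / √m)) := by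
  have hβ₁ : q β ≤ 1 := hq₁ ▸ Finset.single_le_sum (fun a _ => hq a) (Finset.mem_univ β)
  calc iidMean q (fun x : Fin m → X => pairDeviation q x α β)
      ≤ iidMean q ((q α * q β)⁻¹ • ((fun _ => 1 / (m : ℝ)) +
          ((fun x : Fin m → X => |frequency x α - q α|) + fun x => |frequency x β - q β|))) :=
        iidMean_mono hq fun x => pairDeviation_le hα hβ hβ₁ x
    _ ≤ (q α * q β)⁻¹ * (1 / m + (1 / √m + 1 / √m)) := by
        rw [map_smul, map_add, map_add, iidMean_const hq₁, smul_eq_mul]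
        gcongr <;> exact iidMean_abs_frequency_sub_le hm hq hq₁ _

/-- The sum of the relative deviations over the four kinds of pairs. -/
def totalDeviation (q : X → ℝ) (x₀ x₁ : X) (x : Fin m → X) : ℝ :=
  ∑ α ∈ {x₀, x₁}, ∑ β ∈ {x₀, x₁}, pairDeviation q x α β

theorem totalDeviation_nonneg (q : X → ℝ) (x₀ x₁ : X) (x : Fin m → X) :
    0 ≤ totalDeviation q x₀ x₁ x :=
  Finset.sum_nonneg fun _ _ => Finset.sum_nonneg fun _ _ => pairDeviation_nonneg ..

theorem pairDeviation_le_totalDeviation (q : X → ℝ) {x₀ x₁ : X} (x : Fin m → X) {α β : X}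
    (hα : α = x₀ ∨ α = x₁) (hβ : β = x₀ ∨ β = x₁) :
    pairDeviation q x α β ≤ totalDeviation q x₀ x₁ x := by
  have hnonneg (α β : X) := pairDeviation_nonneg q x α β
  calc pairDeviation q x α β ≤ ∑ β ∈ {x₀, x₁}, pairDeviation q x α β :=
        Finset.single_le_sum (f := fun β => pairDeviation q x α β)
          (fun _ _ => hnonneg _ _) (by simpa using hβ)
    _ ≤ totalDeviation q x₀ x₁ x :=
        Finset.single_le_sum (f := fun α => ∑ β ∈ {x₀, x₁}, pairDeviation q x α β)
          (fun _ _ => Finset.sum_nonneg fun _ _ => hnonneg _ _) (by simpa using hα)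

/-- The expectation of `totalDeviation` for `m` independent outcomes. -/
def expectedDeviation [Fintype X] (q : X → ℝ) (x₀ x₁ : X) (m : ℕ) : ℝ :=
  iidMean q fun x : Fin m → X => totalDeviation q x₀ x₁ x

theorem tendsto_iidMean_pairDeviation [Fintype X] {q : X → ℝ} (hq : ∀ a, 0 ≤ q a)
    (hq₁ : ∑ a, q a = 1) {α β : X} (hα : 0 < q α) (hβ : 0 < q β) :
    Filter.Tendsto (fun m => iidMean q fun x : Fin m → X => pairDeviation q x α β) Filter.atTop
      (nhds 0) := by
  have hsqrt : Filter.Tendsto (fun m : ℕ => 1 / √(m : ℝ)) Filter.atTop (nhds 0) :=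
    (Real.tendsto_sqrt_atTop.comp tendsto_natCast_atTop_atTop).const_div_atTop 1
  have hbound := (tendsto_one_div_atTop_nhds_zero_nat.add (hsqrt.add hsqrt)).const_mul
    (q α * q β)⁻¹
  rw [add_zero, add_zero, mul_zero] at hbound
  refine squeeze_zero' (.of_forall fun m => ?_) ((Filter.eventually_gt_atTop 0).mono fun m hm =>
    iidMean_pairDeviation_le hm hq hq₁ hα hβ) hbound
  exact (map_zero (iidMean q)).ge.trans (iidMean_mono hq fun x => pairDeviation_nonneg q x α β)

theorem tendsto_expectedDeviation [Fintype X] {q : X → ℝ} (hq : ∀ a, 0 ≤ q a)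
    (hq₁ : ∑ a, q a = 1) {x₀ x₁ : X} (h₀ : 0 < q x₀) (h₁ : 0 < q x₁) :
    Filter.Tendsto (expectedDeviation q x₀ x₁) Filter.atTop (nhds 0) := by
  have hexpand (m : ℕ) : expectedDeviation q x₀ x₁ m = ∑ α ∈ {x₀, x₁}, ∑ β ∈ {x₀, x₁},
      iidMean q (fun x : Fin m → X => pairDeviation q x α β) := by
    simp only [expectedDeviation, ← map_sum]
    congr 1
    ext x
    simp only [totalDeviation, Finset.sum_apply]
  have hpos (α : X) (hα : α ∈ ({x₀, x₁} : Finset X)) : 0 < q α := by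
    rcases Finset.mem_insert.1 hα with rfl | hα
    · exact h₀
    · rwa [Finset.mem_singleton.1 hα]
  rw [funext hexpand, ← Finset.sum_const_zero (s := ({x₀, x₁} : Finset X))]
  refine tendsto_finsetSum _ fun α hα => ?_
  rw [← Finset.sum_const_zero (s := ({x₀, x₁} : Finset X))]
  exact tendsto_finsetSum _ fun β hβ =>
    tendsto_iidMean_pairDeviation hq hq₁ (hpos α hα) (hpos β hβ)

end Deviation

/-! ### Announcement probabilities -/

section Announcement

variable {X : Type*} [DecidableEq X] {m : ℕ} {q : X → ℝ} {x₀ x₁ α β : X} {x : Fin m → X}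

/-- Alice does not abort when she has measured `x`. -/
def Admissible (x₀ x₁ : X) (x : Fin m → X) : Prop :=
  (pairPositions x x₀ x₀).Nonempty ∧ (pairPositions x x₁ x₁).Nonempty

/-- Alice, having measured `x`, may announce the positions `h`, unless she aborts. -/
def IsChallengePair (x₀ x₁ : X) (x : Fin m → X) (h : Fin m × Fin m) : Prop :=
  h.1 ≠ h.2 ∧ (x h.1 = x₀ ∨ x h.1 = x₁) ∧ (x h.2 = x₀ ∨ x h.2 = x₁)

/-- The weight of a position with outcome `a` in `meanAnnounceProb`. -/
def challengeWeight (q : X → ℝ) (x₀ x₁ a : X) : ℝ :=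
  if a = x₀ ∨ a = x₁ then (q a)⁻¹ else 0

/-- The announcement probability with the number of pairs replaced by about its mean, and without
the abort: it factorises over the two positions. -/
def meanAnnounceProb (q : X → ℝ) (x₀ x₁ : X) (x : Fin m → X) (h : Fin m × Fin m) : ℝ :=
  if h.1 = h.2 then 0
  else challengeWeight q x₀ x₁ (x h.1) * challengeWeight q x₀ x₁ (x h.2) / (4 * m ^ 2)

theorem announceProb_of_not_admissible (hx : ¬ Admissible x₀ x₁ x) (h : Fin m × Fin m) :
    announceProb x₀ x₁ x h = 0 :=
  if_neg fun hcond => hx ⟨hcond.1, hcond.2.1⟩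

theorem announceProb_of_mem_pairPositions (hx : Admissible x₀ x₁ x) (hα : α = x₀ ∨ α = x₁)
    (hβ : β = x₀ ∨ β = x₁) {h : Fin m × Fin m} (hh : h ∈ pairPositions x α β) :
    announceProb x₀ x₁ x h = (4 * ((pairPositions x α β).card : ℝ))⁻¹ := by
  obtain ⟨-, hne, rfl, rfl⟩ := Finset.mem_filter.1 hh
  rw [announceProb, if_pos ⟨hx.1, hx.2, hne, hα, hβ⟩, one_div, one_div, mul_inv]

theorem meanAnnounceProb_of_mem_pairPositions (q : X → ℝ) (hα : α = x₀ ∨ α = x₁)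
    (hβ : β = x₀ ∨ β = x₁) {h : Fin m × Fin m} (hh : h ∈ pairPositions x α β) :
    meanAnnounceProb q x₀ x₁ x h = (4 * (m ^ 2 * (q α * q β)))⁻¹ := by
  obtain ⟨-, hne, rfl, rfl⟩ := Finset.mem_filter.1 hh
  rw [meanAnnounceProb, if_neg hne, challengeWeight, challengeWeight, if_pos hα, if_pos hβ]
  simp only [mul_inv, div_eq_mul_inv]
  ring

theorem sum_eq_sum_pairPositions {f : Fin m × Fin m → ℝ}
    (hf : ∀ h, ¬ IsChallengePair x₀ x₁ x h → f h = 0) :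
    ∑ h, f h = ∑ α ∈ {x₀, x₁}, ∑ β ∈ {x₀, x₁}, ∑ h ∈ pairPositions x α β, f h := by
  simp only [pairPositions, Finset.sum_filter]
  rw [Finset.sum_congr rfl fun α _ => Finset.sum_comm, Finset.sum_comm]
  refine Finset.sum_congr rfl fun h _ => ?_
  by_cases hh : IsChallengePair x₀ x₁ x h
  · obtain ⟨hne, hfst, hsnd⟩ := hh
    simp only [hne, ne_eq, not_false_eq_true, true_and, ite_and, Finset.sum_ite_irrel,
      Finset.sum_const_zero, Finset.sum_ite_eq]
    simp [hfst, hsnd]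
  · simp [hf h hh]

theorem announceProb_eq_zero {h : Fin m × Fin m} (hh : ¬ IsChallengePair x₀ x₁ x h) :
    announceProb x₀ x₁ x h = 0 :=
  if_neg fun hcond => hh hcond.2.2

theorem meanAnnounceProb_eq_zero {h : Fin m × Fin m} (hh : ¬ IsChallengePair x₀ x₁ x h) :
    meanAnnounceProb q x₀ x₁ x h = 0 := by
  simp only [IsChallengePair] at hh
  simp only [meanAnnounceProb, challengeWeight]
  split_ifs <;> simp_all

theorem Admissible.pairPositions_nonempty (hx : Admissible x₀ x₁ x) (hα : α = x₀ ∨ α = x₁)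
    (hβ : β = x₀ ∨ β = x₁) : (pairPositions x α β).Nonempty := by
  obtain ⟨⟨i, hi⟩, ⟨j, hj⟩⟩ := hx
  simp only [pairPositions, Finset.mem_filter, Finset.mem_univ, true_and] at hi hj
  by_cases hne : x₀ = x₁
  · subst hne
    obtain rfl : α = x₀ := or_self_iff.1 hα
    obtain rfl : β = α := or_self_iff.1 hβ
    exact ⟨i, by simpa [pairPositions] using hi⟩
  have hpos (i j : Fin m) (hi : x i = x₀) (hj : x j = x₁) : i ≠ j := by
    rintro rfl
    exact hne (hi.symm.trans hj)
  rcases hα with rfl | rfl <;> rcases hβ with rfl | rfl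
  · exact ⟨i, by simpa [pairPositions] using hi⟩
  · exact ⟨(i.1, j.1), by simp [pairPositions, hpos i.1 j.1, hi, hj]⟩
  · exact ⟨(j.1, i.1), by simp [pairPositions, (hpos i.1 j.1 hi.2.1 hj.2.1).symm, hi, hj]⟩
  · exact ⟨j, by simpa [pairPositions] using hj⟩

theorem Admissible.sum_announceProb (hne : x₀ ≠ x₁) (hx : Admissible x₀ x₁ x) :
    ∑ h, announceProb x₀ x₁ x h = 1 := by
  have hpair : ∀ α ∈ ({x₀, x₁} : Finset X), ∀ β ∈ ({x₀, x₁} : Finset X),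
      ∑ h ∈ pairPositions x α β, announceProb x₀ x₁ x h = 1 / 4 := by
    intro α hα β hβ
    rw [Finset.mem_insert, Finset.mem_singleton] at hα hβ
    have hcard : ((pairPositions x α β).card : ℝ) ≠ 0 :=
      Nat.cast_ne_zero.2 (hx.pairPositions_nonempty hα hβ).card_pos.ne'
    rw [Finset.sum_congr rfl fun h hh => announceProb_of_mem_pairPositions hx hα hβ hh,
      Finset.sum_const, nsmul_eq_mul]
    field_simp
  rw [sum_eq_sum_pairPositions fun h hh => announceProb_eq_zero hh,
    Finset.sum_congr rfl fun α hα => Finset.sum_congr rfl (hpair α hα)]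
  simp only [Finset.sum_pair hne]
  norm_num

theorem one_le_totalDeviation (q : X → ℝ) (hx : ¬ Admissible x₀ x₁ x) :
    1 ≤ totalDeviation q x₀ x₁ x := by
  have hempty {α : X} (hα : α = x₀ ∨ α = x₁) (h : ¬ (pairPositions x α α).Nonempty) :
      1 ≤ totalDeviation q x₀ x₁ x := by
    refine le_trans ?_ (pairDeviation_le_totalDeviation q x hα hα)
    simp [pairDeviation, Finset.not_nonempty_iff_eq_empty.1 h]
  exact (not_and_or.1 hx).elim (hempty (.inl rfl)) (hempty (.inr rfl))

theorem one_sub_totalDeviation_le_sum_announceProb (q : X → ℝ) (hne : x₀ ≠ x₁) (x : Fin m → X) :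
    1 - totalDeviation q x₀ x₁ x ≤ ∑ h, announceProb x₀ x₁ x h := by
  by_cases hx : Admissible x₀ x₁ x
  · linarith [hx.sum_announceProb hne, totalDeviation_nonneg q x₀ x₁ x]
  · simp only [announceProb_of_not_admissible hx, Finset.sum_const_zero]
    linarith [one_le_totalDeviation q hx]

theorem sum_pairPositions_abs_announceProb_sub (hm : 0 < m) (hqα : 0 < q α) (hqβ : 0 < q β)
    (hx : Admissible x₀ x₁ x) (hα : α = x₀ ∨ α = x₁) (hβ : β = x₀ ∨ β = x₁) :
    ∑ h ∈ pairPositions x α β, |announceProb x₀ x₁ x h - meanAnnounceProb q x₀ x₁ x h| =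
      pairDeviation q x α β / 4 := by
  have hm_ne : (m : ℝ) ≠ 0 := Nat.cast_ne_zero.2 hm.ne'
  have hcard : (0 : ℝ) < (pairPositions x α β).card :=
    Nat.cast_pos.2 (hx.pairPositions_nonempty hα hβ).card_pos
  have hconst (h) (hh : h ∈ pairPositions x α β) :
      |announceProb x₀ x₁ x h - meanAnnounceProb q x₀ x₁ x h| =
        |(4 * ((pairPositions x α β).card : ℝ))⁻¹ - (4 * (m ^ 2 * (q α * q β)))⁻¹| := by
    rw [announceProb_of_mem_pairPositions hx hα hβ hh,
      meanAnnounceProb_of_mem_pairPositions q hα hβ hh]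
  rw [Finset.sum_congr rfl hconst, Finset.sum_const, nsmul_eq_mul, ← abs_of_pos hcard, ← abs_mul,
    pairDeviation, abs_of_pos hcard, abs_sub_comm _ (1 : ℝ),
    ← abs_of_pos (by norm_num : (0 : ℝ) < 4), ← abs_div, abs_of_pos (by norm_num : (0 : ℝ) < 4)]
  congr 1
  field_simp [hm_ne]

theorem sum_meanAnnounceProb_le (hne : x₀ ≠ x₁) (x : Fin m → X) :
    ∑ h, meanAnnounceProb q x₀ x₁ x h ≤ 1 + totalDeviation q x₀ x₁ x / 4 := by
  have hpair : ∀ α ∈ ({x₀, x₁} : Finset X), ∀ β ∈ ({x₀, x₁} : Finset X),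
      ∑ h ∈ pairPositions x α β, meanAnnounceProb q x₀ x₁ x h ≤
        (1 + pairDeviation q x α β) / 4 := by
    intro α hα β hβ
    rw [Finset.mem_insert, Finset.mem_singleton] at hα hβ
    rw [Finset.sum_congr rfl fun h hh => meanAnnounceProb_of_mem_pairPositions q hα hβ hh,
      Finset.sum_const, nsmul_eq_mul, pairDeviation, mul_inv, mul_left_comm, ← div_eq_mul_inv,
      ← div_eq_inv_mul]
    linarith [le_abs_self ((pairPositions x α β).card / ((m : ℝ) ^ 2 * (q α * q β)) - 1)]
  rw [sum_eq_sum_pairPositions fun h hh => meanAnnounceProb_eq_zero hh]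
  refine (Finset.sum_le_sum fun α hα => Finset.sum_le_sum (hpair α hα)).trans_eq ?_
  simp only [totalDeviation, Finset.sum_pair hne]
  ring

theorem meanAnnounceProb_nonneg (h₀ : 0 < q x₀) (h₁ : 0 < q x₁) (x : Fin m → X)
    (h : Fin m × Fin m) : 0 ≤ meanAnnounceProb q x₀ x₁ x h := by
  have hweight (a : X) : 0 ≤ challengeWeight q x₀ x₁ a := by
    rw [challengeWeight]
    split_ifs with ha
    · rcases ha with rfl | rfl
      exacts [inv_nonneg.2 h₀.le, inv_nonneg.2 h₁.le]
    · exact le_rfl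
  rw [meanAnnounceProb]
  split_ifs
  · exact le_rfl
  · exact div_nonneg (mul_nonneg (hweight _) (hweight _)) (by positivity)

theorem sum_abs_announceProb_sub_le (hm : 0 < m) (hne : x₀ ≠ x₁) (h₀ : 0 < q x₀) (h₁ : 0 < q x₁)
    (x : Fin m → X) :
    ∑ h, |announceProb x₀ x₁ x h - meanAnnounceProb q x₀ x₁ x h| ≤
      2 * totalDeviation q x₀ x₁ x := by
  have hT := totalDeviation_nonneg q x₀ x₁ x
  by_cases hx : Admissible x₀ x₁ x
  · have hpos (α : X) (hα : α = x₀ ∨ α = x₁) : 0 < q α := by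
      rcases hα with rfl | rfl
      exacts [h₀, h₁]
    have hpair : ∀ α ∈ ({x₀, x₁} : Finset X), ∀ β ∈ ({x₀, x₁} : Finset X),
        ∑ h ∈ pairPositions x α β, |announceProb x₀ x₁ x h - meanAnnounceProb q x₀ x₁ x h| =
          pairDeviation q x α β / 4 := by
      intro α hα β hβ
      rw [Finset.mem_insert, Finset.mem_singleton] at hα hβ
      exact sum_pairPositions_abs_announceProb_sub hm (hpos α hα) (hpos β hβ) hx hα hβ
    have hoff (h) (hh : ¬ IsChallengePair x₀ x₁ x h) :
        |announceProb x₀ x₁ x h - meanAnnounceProb q x₀ x₁ x h| = 0 := by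
      rw [announceProb_eq_zero hh, meanAnnounceProb_eq_zero hh, sub_zero, abs_zero]
    rw [sum_eq_sum_pairPositions hoff,
      Finset.sum_congr rfl fun α hα => Finset.sum_congr rfl (hpair α hα)]
    simp only [← Finset.sum_div]
    change totalDeviation q x₀ x₁ x / 4 ≤ _
    linarith
  · simp only [announceProb_of_not_admissible hx, zero_sub, abs_neg,
      abs_of_nonneg (meanAnnounceProb_nonneg h₀ h₁ x _)]
    linarith [sum_meanAnnounceProb_le (q := q) hne x, one_le_totalDeviation q hx]

end Announcement

/-! ### Strategies based on an ideal functionality -/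

section Separable

/-- If both registers point to the same outcome, then the two single-register bounds multiply;
otherwise the penalties outweigh the gains. -/
theorem separable_payoff_le {c a₀ a₁ b₀ b₁ ka kb : ℝ} (hc : 1 ≤ c) (ha₀ : 0 ≤ a₀) (ha₁ : 0 ≤ a₁)
    (hb₀ : 0 ≤ b₀) (hb₁ : 0 ≤ b₁) (hka : 0 ≤ ka) (hkb : 0 ≤ kb) (hka₀ : a₀ - c * a₁ ≤ ka)
    (hka₁ : a₁ - c * a₀ ≤ ka) (hkb₀ : b₀ - c * b₁ ≤ kb) (hkb₁ : b₁ - c * b₀ ≤ kb) :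
    a₀ * b₀ + a₁ * b₁ - 2 * c * (a₀ * b₁ + a₁ * b₀) ≤ ka * kb := by
  have h00 : 0 ≤ a₀ * b₀ := mul_nonneg ha₀ hb₀
  have h11 : 0 ≤ a₁ * b₁ := mul_nonneg ha₁ hb₁
  have hc_sq : 1 ≤ c ^ 2 := one_le_pow₀ hc
  have h01 : 0 ≤ c * (a₀ * b₁) := by positivity
  have h10 : 0 ≤ c * (a₁ * b₀) := by positivity
  by_cases hzero : 0 ≤ a₀ - c * a₁ ∧ 0 ≤ b₀ - c * b₁
  · nlinarith [mul_le_mul hka₀ hkb₀ hzero.2 hka, mul_le_mul_of_nonneg_right hc_sq h11]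
  by_cases hone : 0 ≤ a₁ - c * a₀ ∧ 0 ≤ b₁ - c * b₀
  · nlinarith [mul_le_mul hka₁ hkb₁ hone.2 hka, mul_le_mul_of_nonneg_right hc_sq h00]
  have hgain₀ : a₀ * b₀ ≤ c * (a₀ * b₁ + a₁ * b₀) := by
    rcases not_and_or.1 hzero with h | h
    · nlinarith [mul_le_mul_of_nonneg_right (le_of_not_ge h) hb₀]
    · nlinarith [mul_le_mul_of_nonneg_left (le_of_not_ge h) ha₀]
  have hgain₁ : a₁ * b₁ ≤ c * (a₀ * b₁ + a₁ * b₀) := by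
    rcases not_and_or.1 hone with h | h
    · nlinarith [mul_le_mul_of_nonneg_right (le_of_not_ge h) hb₁]
    · nlinarith [mul_le_mul_of_nonneg_left (le_of_not_ge h) ha₁]
  linarith [mul_nonneg hka hkb]

variable {X : Type*} [DecidableEq X] {q : X → ℝ} {x₀ x₁ : X} {ω : ℂ} {δ : ℝ}

/-- The vector `|x₀⟩ / √(q x₀) - ω |x₁⟩ / √(q x₁)`, at which the quadratic form of Alice's reduced
state bounds how well Bob can tell `x₀` from `x₁` on one register. The phase `ω` is to be aligned
with the inner product of Bob's conditional states. -/
def witness (q : X → ℝ) (x₀ x₁ : X) (ω : ℂ) : X → ℂ :=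
  Pi.single x₀ ((√(q x₀) : ℝ) : ℂ)⁻¹ - Pi.single x₁ (((√(q x₁) : ℝ) : ℂ)⁻¹ * ω)

theorem norm_ofReal_sqrt_inv_sq {r : ℝ} (hr : 0 ≤ r) : ‖((√r : ℝ) : ℂ)⁻¹‖ ^ 2 = r⁻¹ := by
  rw [norm_inv, Complex.norm_real, inv_pow, Real.norm_eq_abs, sq_abs, Real.sq_sqrt hr]

theorem sum_challengeWeight_mul [Fintype X] (hne : x₀ ≠ x₁) (q f : X → ℝ) :
    ∑ a, challengeWeight q x₀ x₁ a * f a = (q x₀)⁻¹ * f x₀ + (q x₁)⁻¹ * f x₁ := by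
  have hmem (a : X) : challengeWeight q x₀ x₁ a * f a =
      if a ∈ ({x₀, x₁} : Finset X) then (q a)⁻¹ * f a else 0 := by
    simp [challengeWeight, ite_mul]
  simp only [hmem, Finset.sum_ite_mem, Finset.univ_inter, Finset.sum_pair hne]

theorem sub_le_quadForm_witness [Fintype X] (h₀ : 0 ≤ q x₀) (h₁ : 0 ≤ q x₁) (hω : ‖ω‖ = 1)
    (hδ₀ : 0 < δ) (hδ₁ : δ < 1) {G : Matrix X X ℂ} (hG : G.PosSemidef) :
    (q x₀)⁻¹ * (G x₀ x₀).re - δ⁻¹ * ((q x₁)⁻¹ * (G x₁ x₁).re) ≤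
        (1 - δ)⁻¹ * quadForm (witness q x₀ x₁ ω) G ∧
      (q x₁)⁻¹ * (G x₁ x₁).re - δ⁻¹ * ((q x₀)⁻¹ * (G x₀ x₀).re) ≤
        (1 - δ)⁻¹ * quadForm (witness q x₀ x₁ ω) G := by
  set u : X → ℂ := Pi.single x₀ ((√(q x₀) : ℝ) : ℂ)⁻¹
  set w : X → ℂ := Pi.single x₁ (((√(q x₁) : ℝ) : ℂ)⁻¹ * ω)
  have hu : quadForm u G = (q x₀)⁻¹ * (G x₀ x₀).re := by
    rw [quadForm_single, norm_ofReal_sqrt_inv_sq h₀]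
  have hw : quadForm w G = (q x₁)⁻¹ * (G x₁ x₁).re := by
    rw [quadForm_single, norm_mul, hω, mul_one, norm_ofReal_sqrt_inv_sq h₁]
  have hneg : quadForm (w - u) G = quadForm (u - w) G := by
    simpa using quadForm_smul (-1) (u - w) G
  have huw := quadForm_le_add hG hδ₀ hδ₁ u w
  have hwu := quadForm_le_add hG hδ₀ hδ₁ w u
  rw [hneg] at hwu
  rw [← hu, ← hw]
  exact ⟨sub_le_iff_le_add.2 huw, sub_le_iff_le_add.2 hwu⟩

theorem sum_mul_score_le_quadForm_witness [Fintype X] (hne : x₀ ≠ x₁) (h₀ : 0 ≤ q x₀)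
    (h₁ : 0 ≤ q x₁) (hω : ‖ω‖ = 1) (hδ₀ : 0 < δ) (hδ₁ : δ < 1) {A B : Matrix X X ℂ}
    (hA : A.PosSemidef) (hB : B.PosSemidef) (o : Option Bool) :
    ∑ a, ∑ b, (A a a).re * (B b b).re * (challengeWeight q x₀ x₁ a * challengeWeight q x₀ x₁ b *
        score (2 * δ⁻¹) (decide (a = b)) o) ≤
      (1 - δ)⁻¹ * quadForm (witness q x₀ x₁ ω) A *
        ((1 - δ)⁻¹ * quadForm (witness q x₀ x₁ ω) B) := by
  have hδ : 0 ≤ (1 - δ)⁻¹ := inv_nonneg.2 (sub_nonneg.2 hδ₁.le)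
  have hfactor (a b : X) : (A a a).re * (B b b).re * (challengeWeight q x₀ x₁ a *
        challengeWeight q x₀ x₁ b * score (2 * δ⁻¹) (decide (a = b)) o) =
      challengeWeight q x₀ x₁ a * ((A a a).re * (challengeWeight q x₀ x₁ b *
        ((B b b).re * score (2 * δ⁻¹) (decide (a = b)) o))) := by
    ring
  simp only [hfactor, ← Finset.mul_sum, sum_challengeWeight_mul hne]
  obtain ⟨hA₀₁, hA₁₀⟩ := sub_le_quadForm_witness h₀ h₁ hω hδ₀ hδ₁ hA
  obtain ⟨hB₀₁, hB₁₀⟩ := sub_le_quadForm_witness h₀ h₁ hω hδ₀ hδ₁ hB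
  have hκA := mul_nonneg hδ (quadForm_nonneg (witness q x₀ x₁ ω) hA)
  have hκB := mul_nonneg hδ (quadForm_nonneg (witness q x₀ x₁ ω) hB)
  have hdiag {G : Matrix X X ℂ} (hG : G.PosSemidef) {x : X} (hx : 0 ≤ q x) :
      0 ≤ (q x)⁻¹ * (G x x).re :=
    mul_nonneg (inv_nonneg.2 hx) (Complex.le_def.1 hG.diag_nonneg).1
  have hδ_inv : 1 ≤ δ⁻¹ := (one_le_inv₀ hδ₀).2 hδ₁.le
  match o with
  | none => simpa [score] using mul_nonneg hκA hκB
  | some true =>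
    have := separable_payoff_le hδ_inv (hdiag hA h₀) (hdiag hA h₁) (hdiag hB h₀) (hdiag hB h₁)
      hκA hκB hA₀₁ hA₁₀ hB₀₁ hB₁₀
    simp only [score, hne, hne.symm, decide_true, decide_false, if_true,
      Bool.true_eq_false, if_false]
    linarith
  | some false =>
    have := separable_payoff_le hδ_inv (hdiag hA h₀) (hdiag hA h₁) (hdiag hB h₁) (hdiag hB h₀)
      hκA hκB hA₀₁ hA₁₀ hB₁₀ hB₀₁
    simp only [score, hne, hne.symm, decide_true, decide_false, if_true,
      Bool.false_eq_true, if_false]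
    linarith

theorem exists_quadForm_witness_eq {Y : Type*} [Fintype X] [Fintype Y] {P : X × Y → ℝ}
    {ψ : EuclideanSpace ℂ (X × Y)} (hψ : IsRegularEmbedding P ψ) (h₀ : 0 < marginal P x₀)
    (h₁ : 0 < marginal P x₁) :
    ∃ ω : ℂ, ‖ω‖ = 1 ∧
      quadForm (witness (marginal P) x₀ x₁ ω) (partialTrace (initialState ψ)) =
        2 * (1 - ‖inner ℂ (condState P ψ x₀) (condState P ψ x₁)‖) := by
  obtain ⟨ω, hω, hinner⟩ :=
    Complex.exists_norm_eq_mul_self (inner ℂ (condState P ψ x₀) (condState P ψ x₁))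
  have hsum : ∑ x, star (witness (marginal P) x₀ x₁ (star ω) x) • branch ψ x =
      condState P ψ x₀ - ω • condState P ψ x₁ := by
    simp [witness, Pi.single_apply, sub_smul, Finset.sum_sub_distrib, apply_ite (starRingEnd ℂ),
      ite_smul, condState_eq_smul_branch, smul_smul, mul_comm]
  refine ⟨star ω, (norm_star ω).trans hω, ?_⟩
  rw [quadForm_partialTrace_initialState, hsum, norm_sub_sq (𝕜 := ℂ), norm_smul, hω, one_mul,
    norm_condState hψ h₀, norm_condState hψ h₁, inner_smul_right, ← hinner]
  simp only [RCLike.re_to_complex, Complex.ofReal_re]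
  ring

end Separable

section SimulatedPayoff

theorem abs_score_le {c : ℝ} (hc : 1 ≤ c) (equal : Bool) (o : Option Bool) :
    |score c equal o| ≤ c := by
  rcases o with _ | b
  · rw [score, abs_zero]
    linarith
  · rw [score]
    split_ifs
    · rwa [abs_one]
    · rw [abs_neg, abs_of_nonneg (by linarith)]

theorem challengePayoff_le_mean_add {X : Type*} [Fintype X] [DecidableEq X] {q : X → ℝ} {x₀ x₁ : X}
    {m : ℕ} (hm : 0 < m) (hne : x₀ ≠ x₁) (h₀ : 0 < q x₀) (h₁ : 0 < q x₁) {c : ℝ}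
    {R : Fin m × Fin m → (Fin m → X) → Option Bool → ℝ}
    (hR : ∀ h x, |∑ b, R h x b * score c (decide (x h.1 = x h.2)) b| ≤ (∏ k, q (x k)) * c) :
    challengePayoff x₀ x₁ c R ≤
      ∑ h, ∑ x, meanAnnounceProb q x₀ x₁ x h *
          ∑ b, R h x b * score c (decide (x h.1 = x h.2)) b +
        2 * c * expectedDeviation q x₀ x₁ m := by
  let gain (h : Fin m × Fin m) (x : Fin m → X) : ℝ :=
    ∑ b, R h x b * score c (decide (x h.1 = x h.2)) b
  let error (h : Fin m × Fin m) (x : Fin m → X) : ℝ :=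
    |announceProb x₀ x₁ x h - meanAnnounceProb q x₀ x₁ x h|
  have hterm (x h) : announceProb x₀ x₁ x h * gain h x ≤
      meanAnnounceProb q x₀ x₁ x h * gain h x + error h x * ((∏ k, q (x k)) * c) := by
    rw [← sub_le_iff_le_add', ← sub_mul]
    refine (le_abs_self _).trans ?_
    rw [abs_mul]
    exact mul_le_mul_of_nonneg_left (hR h x) (abs_nonneg _)
  calc challengePayoff x₀ x₁ c R
      ≤ ∑ x, ∑ h, (meanAnnounceProb q x₀ x₁ x h * gain h x +
          error h x * ((∏ k, q (x k)) * c)) :=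
        Finset.sum_le_sum fun x _ => Finset.sum_le_sum fun h _ => hterm x h
    _ = ∑ h, ∑ x, meanAnnounceProb q x₀ x₁ x h * gain h x +
          ∑ x, (∑ h, error h x) * ((∏ k, q (x k)) * c) := by
        simp only [Finset.sum_add_distrib, Finset.sum_mul]
        rw [Finset.sum_comm]
    _ ≤ ∑ h, ∑ x, meanAnnounceProb q x₀ x₁ x h * gain h x +
          ∑ x, 2 * totalDeviation q x₀ x₁ x * ((∏ k, q (x k)) * c) := by
        gcongr with x _
        · exact (abs_nonneg _).trans (hR (⟨0, hm⟩, ⟨0, hm⟩) x)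
        · exact sum_abs_announceProb_sub_le hm hne h₀ h₁ x
    _ = ∑ h, ∑ x, meanAnnounceProb q x₀ x₁ x h * gain h x +
          2 * c * expectedDeviation q x₀ x₁ m := by
        rw [expectedDeviation, iidMean_apply, Finset.mul_sum]
        congr 1
        exact Finset.sum_congr rfl fun x _ => by ring

variable {X Y : Type*} [Fintype X] [Fintype Y] [DecidableEq X] [DecidableEq Y] {P : X × Y → ℝ}
  {ψ : EuclideanSpace ℂ (X × Y)} {x₀ x₁ : X} {m : ℕ}

theorem abs_sum_simProb_mul_score_le (hψ : IsRegularEmbedding P ψ) {c : ℝ} (hc : 1 ≤ c)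
    (F : unitInterval → Instrument Y) (S : Simulator m (Option Bool)) (x : Fin m → X)
    (equal : Bool) :
    |∑ b, simProb F ψ S x b * score c equal b| ≤ (∏ k, marginal P (x k)) * c := by
  have hσ (_ : Fin m) := initialState_posSemidef ψ
  calc |∑ b, simProb F ψ S x b * score c equal b|
      ≤ ∑ b, simProb F ψ S x b * c := by
        refine (Finset.abs_sum_le_sum_abs _ _).trans (Finset.sum_le_sum fun b _ => ?_)
        have hprob : 0 ≤ simProb F ψ S x b := S.prob_nonneg F hσ x b
        rw [abs_mul, abs_of_nonneg hprob]
        exact mul_le_mul_of_nonneg_left (abs_score_le hc _ _) hprob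
    _ ≤ (∏ k, marginal P (x k)) * c := by
        rw [← Finset.sum_mul]
        refine mul_le_mul_of_nonneg_right ((S.sum_prob_le F hσ x).trans_eq ?_) (by linarith)
        simp only [partialTrace_initialState_diag_re, norm_branch_sq hψ]

theorem sum_meanAnnounceProb_mul_score_le (hP : ∑ p, P p = 1) (hψ : IsRegularEmbedding P ψ)
    (hne : x₀ ≠ x₁) (h₀ : 0 < marginal P x₀) (h₁ : 0 < marginal P x₁) {s : ℝ}
    (hs : ‖inner ℂ (condState P ψ x₀) (condState P ψ x₁)‖ = s) {δ : ℝ} (hδ₀ : 0 < δ) (hδ₁ : δ < 1)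
    (F : unitInterval → Instrument Y) (S : Simulator m (Option Bool)) (h : Fin m × Fin m) :
    ∑ x : Fin m → X, meanAnnounceProb (marginal P) x₀ x₁ x h *
        ∑ b, simProb F ψ S x b * score (2 * δ⁻¹) (decide (x h.1 = x h.2)) b ≤
      ((1 - δ)⁻¹ * (1 - s)) ^ 2 / m ^ 2 := by
  by_cases hij : h.1 = h.2
  · simp only [meanAnnounceProb, hij, if_true, zero_mul, Finset.sum_const_zero]
    positivity
  obtain ⟨ω, hω, hquad⟩ := exists_quadForm_witness_eq hψ h₀ h₁
  have htrace : reTrace (partialTrace (initialState ψ)) = 1 := by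
    simp only [reTrace_apply, partialTrace_initialState_diag_re, norm_branch_sq hψ,
      sum_marginal, hP]
  have hpair := S.sum_prob_mul_pair_le F hij
    (κ := (1 - δ)⁻¹ • quadForm (witness (marginal P) x₀ x₁ ω))
    (fun A B hA hB => sum_mul_score_le_quadForm_witness hne h₀.le h₁.le hω hδ₀ hδ₁ hA hB)
    (fun _ => initialState_posSemidef ψ)
  simp only [LinearMap.smul_apply, smul_eq_mul, hquad, hs, htrace, Finset.prod_const_one,
    mul_one] at hpair
  calc ∑ x : Fin m → X, meanAnnounceProb (marginal P) x₀ x₁ x h *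
        ∑ b, simProb F ψ S x b * score (2 * δ⁻¹) (decide (x h.1 = x h.2)) b
      = (∑ x : Fin m → X, ∑ b, S.prob F (fun _ => initialState ψ) x b *
          (challengeWeight (marginal P) x₀ x₁ (x h.1) * challengeWeight (marginal P) x₀ x₁ (x h.2) *
            score (2 * δ⁻¹) (decide (x h.1 = x h.2)) b)) / (4 * m ^ 2) := by
        simp only [meanAnnounceProb, hij, if_false, Finset.mul_sum, Finset.sum_div, simProb]
        exact Finset.sum_congr rfl fun x _ => Finset.sum_congr rfl fun b _ => by ring
    _ ≤ (1 - δ)⁻¹ * (2 * (1 - s)) * ((1 - δ)⁻¹ * (2 * (1 - s))) / (4 * m ^ 2) := by gcongr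
    _ = ((1 - δ)⁻¹ * (1 - s)) ^ 2 / m ^ 2 := by
        field_simp
        ring

theorem challengePayoff_simProb_le (hP : ∑ p, P p = 1) (hψ : IsRegularEmbedding P ψ)
    (hne : x₀ ≠ x₁) (h₀ : 0 < marginal P x₀) (h₁ : 0 < marginal P x₁) {s : ℝ}
    (hs : ‖inner ℂ (condState P ψ x₀) (condState P ψ x₁)‖ = s) {δ : ℝ} (hδ₀ : 0 < δ) (hδ₁ : δ < 1)
    (hm : 0 < m) (F : unitInterval → Instrument Y)
    (S : Fin m × Fin m → Simulator m (Option Bool)) :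
    challengePayoff x₀ x₁ (2 * δ⁻¹) (fun h => simProb F ψ (S h)) ≤
      ((1 - δ)⁻¹ * (1 - s)) ^ 2 +
        2 * (2 * δ⁻¹) * expectedDeviation (marginal P) x₀ x₁ m := by
  have hc : 1 ≤ 2 * δ⁻¹ := by linarith [(one_le_inv₀ hδ₀).2 hδ₁.le]
  refine (challengePayoff_le_mean_add hm hne h₀ h₁ fun h x =>
    abs_sum_simProb_mul_score_le hψ hc F (S h) x _).trans ?_
  gcongr
  calc _ ≤ ∑ _h : Fin m × Fin m, ((1 - δ)⁻¹ * (1 - s)) ^ 2 / (m : ℝ) ^ 2 :=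
        Finset.sum_le_sum fun h _ =>
          sum_meanAnnounceProb_mul_score_le hP hψ hne h₀ h₁ hs hδ₀ hδ₁ F (S h) h
    _ = ((1 - δ)⁻¹ * (1 - s)) ^ 2 := by
        rw [Finset.sum_const, Finset.card_univ, Fintype.card_prod, Fintype.card_fin, nsmul_eq_mul,
          Nat.cast_mul, ← sq, mul_div_cancel₀ _ (pow_ne_zero 2 (Nat.cast_ne_zero.2 hm.ne'))]

end SimulatedPayoff

/-! ### The advantage of the coherent strategy -/

section Advantage

variable {X Y : Type*} [Fintype X] [Fintype Y] [DecidableEq X] [DecidableEq Y] {P : X × Y → ℝ}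
  {ψ : EuclideanSpace ℂ (X × Y)} {x₀ x₁ : X}

theorem challengePayoff_eq_sum_mul_sum_announceProb {m : ℕ}
    {R : Fin m × Fin m → (Fin m → X) → Option Bool → ℝ} {w : (Fin m → X) → ℝ}
    (hR : ∀ h x, IsChallengePair x₀ x₁ x h → ∀ e, R h x (some e) =
      if e = decide (x h.1 = x h.2) then w x else 0) (c : ℝ) :
    challengePayoff x₀ x₁ c R = ∑ x, w x * ∑ h, announceProb x₀ x₁ x h := by
  refine Finset.sum_congr rfl fun x _ => ?_
  rw [mul_comm, Finset.sum_mul]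
  refine Finset.sum_congr rfl fun h _ => ?_
  by_cases hh : IsChallengePair x₀ x₁ x h
  · congr 1
    rw [Fintype.sum_option, Fintype.sum_bool, hR h x hh, hR h x hh]
    by_cases he : x h.1 = x h.2 <;> simp [he, score]
  · rw [announceProb_eq_zero hh, zero_mul, zero_mul]

theorem exists_coherent_strategy (hP : ∑ p, P p = 1) (hψ : IsRegularEmbedding P ψ) (hne : x₀ ≠ x₁)
    (h₀ : 0 < marginal P x₀) (h₁ : 0 < marginal P x₁) {s : ℝ}
    (hs : ‖inner ℂ (condState P ψ x₀) (condState P ψ x₁)‖ = s) (hs₁ : s < 1) (c : ℝ) (m : ℕ) :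
    ∃ E : Fin m × Fin m → POVM (Fin m → Y) (Option Bool),
      (1 - s) * (1 - expectedDeviation (marginal P) x₀ x₁ m) ≤
        challengePayoff x₀ x₁ c (fun h => attackProb ψ (E h)) := by
  have hcompare (h : Fin m × Fin m) : ∃ E : POVM (Fin m → Y) (Option Bool), ∀ x : Fin m → X,
      IsChallengePair x₀ x₁ x h → ∀ e, attackProb ψ E x (some e) =
        if e = decide (x h.1 = x h.2) then (1 - s) * ∏ k, marginal P (x k) else 0 := by
    by_cases hij : h.1 = h.2
    · exact ⟨POVM.const none, fun x hx => absurd hij hx.1⟩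
    · obtain ⟨E, hE⟩ := exists_attackProb_eq_comparison hψ h₀ h₁ hs hs₁ hij
      exact ⟨E, fun x hx e => by rw [hE x hx.2.1 hx.2.2, ite_mul, zero_mul]⟩
  choose E hE using hcompare
  refine ⟨E, ?_⟩
  calc (1 - s) * (1 - expectedDeviation (marginal P) x₀ x₁ m)
      = (1 - s) * iidMean (marginal P)
          (fun x : Fin m → X => 1 - totalDeviation (marginal P) x₀ x₁ x) := by
        congr 1
        conv_lhs => rw [← iidMean_const (ι := Fin m) ((sum_marginal P).trans hP) 1]
        exact (map_sub (iidMean (marginal P)) _ _).symm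
    _ ≤ (1 - s) * iidMean (marginal P) (fun x : Fin m → X => ∑ h, announceProb x₀ x₁ x h) :=
        mul_le_mul_of_nonneg_left (iidMean_mono (marginal_nonneg hψ) fun x =>
          one_sub_totalDeviation_le_sum_announceProb _ hne x) (sub_nonneg.2 hs₁.le)
    _ = challengePayoff x₀ x₁ c (fun h => attackProb ψ (E h)) := by
        rw [challengePayoff_eq_sum_mul_sum_announceProb hE, iidMean_apply, Finset.mul_sum]
        simp only [mul_assoc]

/-- In the challenge with parameters `x₀`, `x₁` and a suitable penalty `c`, and for all large
numbers of registers, some coherent strategy beats all strategies based on local measurements,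
whatever their repertoire `F`, by a fixed margin. -/
def HasCoherentAdvantage (ψ : EuclideanSpace ℂ (X × Y)) (x₀ x₁ : X) : Prop :=
  ∃ c : ℝ, 0 < c ∧ ∃ ε : ℝ, 0 < ε ∧ ∃ M : ℕ, ∀ m ≥ M,
    ∃ E : Fin m × Fin m → POVM (Fin m → Y) (Option Bool),
      ∀ (F : unitInterval → Instrument Y) (S : Fin m × Fin m → Simulator m (Option Bool)),
        challengePayoff x₀ x₁ c (fun h => simProb F ψ (S h)) + ε ≤
          challengePayoff x₀ x₁ c (fun h => attackProb ψ (E h))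

theorem HasCoherentAdvantage.not_simulatesAttacks (hadv : HasCoherentAdvantage ψ x₀ x₁)
    (F : unitInterval → Instrument Y) : ¬ SimulatesAttacks F ψ := by
  intro hF
  obtain ⟨c, -, ε, hε, M, hM⟩ := hadv
  obtain ⟨E, hE⟩ := hM (M + 1) M.le_succ
  choose S hS using fun h => hF (M + 1) M.succ_pos (Option Bool) (E h)
  have hsim : (fun h => simProb F ψ (S h)) = fun h => attackProb ψ (E h) :=
    funext fun h => funext fun x => funext fun o => hS h x o
  have := hE F S
  rw [hsim] at this
  linarith

theorem sq_inv_one_sub_half_mul_lt {s : ℝ} (hs₀ : 0 < s) (hs₁ : s < 1) :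
    ((1 - s / 2)⁻¹ * (1 - s)) ^ 2 < 1 - s := by
  have hpos : 0 < 1 - s / 2 := by linarith
  rw [inv_mul_eq_div, div_pow, div_lt_iff₀ (by positivity), sq]
  refine mul_lt_mul_of_pos_left ?_ (sub_pos.2 hs₁)
  nlinarith

theorem hasCoherentAdvantage_of_overlap (hP : ∑ p, P p = 1) (hψ : IsRegularEmbedding P ψ)
    (h₀ : 0 < marginal P x₀) (h₁ : 0 < marginal P x₁)
    (hs₀ : 0 < ‖inner ℂ (condState P ψ x₀) (condState P ψ x₁)‖)
    (hs₁ : ‖inner ℂ (condState P ψ x₀) (condState P ψ x₁)‖ < 1) : HasCoherentAdvantage ψ x₀ x₁ := by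
  have hne : x₀ ≠ x₁ := by
    rintro rfl
    simp [inner_self_eq_norm_sq_to_K, norm_condState hψ h₀] at hs₁
  obtain ⟨s, hs⟩ : ∃ s, ‖inner ℂ (condState P ψ x₀) (condState P ψ x₁)‖ = s := ⟨_, rfl⟩
  rw [hs] at hs₀ hs₁
  set c : ℝ := 2 * (s / 2)⁻¹
  set gap : ℝ := (1 - s) - ((1 - s / 2)⁻¹ * (1 - s)) ^ 2
  have hgap : 0 < gap := sub_pos.2 (sq_inv_one_sub_half_mul_lt hs₀ hs₁)
  have hlim : Filter.Tendsto (fun m => (2 * c + (1 - s)) * expectedDeviation (marginal P) x₀ x₁ m)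
      Filter.atTop (nhds 0) := by
    simpa using (tendsto_expectedDeviation (marginal_nonneg hψ)
      ((sum_marginal P).trans hP) h₀ h₁).const_mul (2 * c + (1 - s))
  obtain ⟨M, hM⟩ := Filter.eventually_atTop.1
    ((hlim.eventually_le_const (half_pos hgap)).and (Filter.eventually_gt_atTop 0))
  refine ⟨c, by positivity, gap / 2, half_pos hgap, M, fun m hm => ?_⟩
  obtain ⟨hsmall, hm₀⟩ := hM m hm
  obtain ⟨E, hE⟩ := exists_coherent_strategy hP hψ hne h₀ h₁ hs hs₁ c m
  refine ⟨E, fun F S => ?_⟩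
  have hS := challengePayoff_simProb_le hP hψ hne h₀ h₁ hs (half_pos hs₀) (by linarith) hm₀ F S
  linarith

end Advantage

end Composability

end

theorem mainTheorem2_general {X Y : Type*} [Fintype X] [Fintype Y] [DecidableEq X] [DecidableEq Y]
    {P : X × Y → ℝ} (hP : ∑ p, P p = 1) {ψ : EuclideanSpace ℂ (X × Y)}
    (hψ : Composability.IsRegularEmbedding P ψ) :
    ((∃ F, Composability.SimulatesAttacks F ψ) → Composability.depEntropy P ψ = 0) ∧
    (Composability.depEntropy P ψ ≠ 0 →
      ∃ x₀ x₁ : X, 0 < Composability.marginal P x₀ ∧ 0 < Composability.marginal P x₁ ∧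
        0 < ‖inner ℂ (Composability.condState P ψ x₀) (Composability.condState P ψ x₁)‖ ∧
        ‖inner ℂ (Composability.condState P ψ x₀) (Composability.condState P ψ x₁)‖ < 1 ∧
        Composability.HasCoherentAdvantage ψ x₀ x₁) := by
  by_cases hdep : Composability.depEntropy P ψ = 0
  · exact ⟨fun _ => hdep, fun hne => absurd hdep hne⟩
  obtain ⟨x₀, x₁, h₀, h₁, hs₀, hs₁⟩ := Composability.exists_overlap_of_depEntropy_ne_zero hψ hdep
  have hadv := Composability.hasCoherentAdvantage_of_overlap hP hψ h₀ h₁ hs₀ hs₁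
  exact ⟨fun ⟨F, hF⟩ => absurd hF (hadv.not_simulatesAttacks F),
    fun _ => ⟨x₀, x₁, h₀, h₁, hs₀, hs₁, hadv⟩⟩

theorem mainTheorem2 {X Y : Type*} [Fintype X] [Fintype Y] [DecidableEq X] [DecidableEq Y]
    (P : X × Y → ℝ) (hP : P ∈ stdSimplex ℝ (X × Y))
    (ψ : EuclideanSpace ℂ (X × Y)) (hψ : Composability.IsRegularEmbedding P ψ) :
    (Composability.WeaklySelfComposable ψ → Composability.IsTrivial P ψ) ∧
    (¬ Composability.IsTrivial P ψ →
      ∃ x₀ x₁ : X,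
        0 < ‖inner ℂ (Composability.condState P ψ x₀) (Composability.condState P ψ x₁)‖ ∧
        ‖inner ℂ (Composability.condState P ψ x₀) (Composability.condState P ψ x₁)‖ < 1 ∧
        ∃ c : ℝ, 0 < c ∧ ∃ ε : ℝ, 0 < ε ∧ ∃ M : ℕ, ∀ m ≥ M,
          ∃ E : Fin m × Fin m → Composability.POVM (Fin m → Y) (Option Bool),
            ∀ (I : Composability.IdealFunctionality X Y)
              (S : Fin m × Fin m → Composability.Simulator m (Option Bool)),
              Composability.challengePayoff x₀ x₁ c
                  (fun h => Composability.simProb I.bob ψ (S h)) + ε ≤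
                Composability.challengePayoff x₀ x₁ c
                  (fun h => Composability.attackProb ψ (E h))) := by
  obtain ⟨hzero, hadvantage⟩ := mainTheorem2_general hP.2 hψ
  refine ⟨fun ⟨I, hI, _⟩ => .inr (hzero ⟨I.bob, hI⟩), fun hnontrivial => ?_⟩
  obtain ⟨x₀, x₁, -, -, hs₀, hs₁, c, hc, ε, hε, M, hM⟩ := hadvantage (not_or.1 hnontrivial).2
  exact ⟨x₀, x₁, hs₀, hs₁, c, hc, ε, hε, M, fun m hm =>
    (hM m hm).imp fun E hE I S => hE I.bob S⟩
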